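/- Let $d\in\mathbb N$, $\sigma(t)=\sqrt{2(1-t)/t}$, let $W$ be a $d$-dimensional Brownian motion with respect to a filtration $(\mathcal F_t)$, and let $X=(X_t)_{0<t\le 1}$ be a base dynamic with drift $b(x,t)\in\mathbb R^d$, i.e. an adapted process with a.s. continuous paths on $(0,1]$ such that, for all $0<s\le t\le 1$, almost surely $$X_t=X_s+\int_s^t b(X_r,r)\,dr+\int_s^t\sigma(r)\,dW_r ,$$ where a.s. $r\mapsto b(X_r,r)$ is integrable on $[s,1]$ for every $s\in(0,1]$, with initial law $p_0=N(0,I)$. Since $\sigma^2$ is not integrable at $0$, the laws at time $0$ are understood as weak limits: $\mathrm{Law}(X_s)\to p_0=N(0,I)$ as $s\downarrow 0$, and $p_{0,1}$ is the weak limit of $\mathrm{Law}(X_s,X_1)$ as $s\downarrow0$. Consider the following conditions. 1. (Linearity) $b(x,t)=D(t)x$ for all $x$ and almost every $t\in(0,1]$, for some scalar function $D$ that is integrable on $[t,1]$ for every $t\in(0,1]$. 2. (Memorylessness) $p_{0,1}=p_0\otimes p_1$, where $p_1=\mathrm{Law}(X_1)$. 3. (Noising kernel) For every $t\in(0,1]$,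 the conditional law of $X_t$ given $X_1$ is $N(tX_1,(1-t)^2I)$. Then conditions 1, 2 and 3 all hold if and only if there is a constant $C>\tfrac12$ such that $$b(x,t)=D(t)x,\qquad D(t)=\frac{2Ct^2-1}{t\,(2Ct^2-2t+1)}$$ for all $x\in\mathbb R^d$ and almost every $t\in(0,1]$. If moreover $t\mapsto b(x,t)$ is continuous on $(0,1]$ for each $x$, then conditions 1, 2 and 3 all hold if and only if, for some constant $C>\tfrac12$, this formula holds for all $x\in\mathbb R^d$ and every $t\in(0,1]$. Finally, whenever the drift is of this form (for almost every $t$) with a constant $C>\tfrac12$, the terminal marginal is $p_1=N(0,(2C-1)I)$. -/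

import Mathlib

open MeasureTheory ProbabilityTheory Set Filter Topology
open scoped NNReal BoundedContinuousFunction

noncomputable section

/-- The fixed diffusion coefficient `σ(t) = √(2(1-t)/t)`, used for `0 < t ≤ 1`. -/
def diffusionCoeff (t : ℝ) : ℝ := Real.sqrt (2 * (1 - t) / t)

/-- The isotropic Gaussian measure `N(m, v I)` on `ℝᵈ` (for `v ≥ 0`). -/
def isoGaussian {d : ℕ} (m : EuclideanSpace ℝ (Fin d)) (v : ℝ) :
    Measure (EuclideanSpace ℝ (Fin d)) :=
  multivariateGaussian m (v • (1 : Matrix (Fin d) (Fin d) ℝ))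

theorem isoGaussian_sq_eq_map {d : ℕ} (m : EuclideanSpace ℝ (Fin d)) {a : ℝ} (ha : 0 ≤ a) :
    isoGaussian m (a ^ 2)
      = (isoGaussian (0 : EuclideanSpace ℝ (Fin d)) 1).map (fun z => m + a • z) := by
  have h1 : (a ^ 2 • (1 : Matrix (Fin d) (Fin d) ℝ)).PosSemidef :=
    Matrix.PosSemidef.one.smul (sq_nonneg a)
  unfold isoGaussian
  rw [one_smul, multivariateGaussian_zero_one]
  apply Measure.ext_of_charFun
  ext t
  have h2 : (fun z : EuclideanSpace ℝ (Fin d) => m + a • z)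
      = (fun z => m + z) ∘ (fun z => a • z) := rfl
  have h3 : t.ofLp ⬝ᵥ t.ofLp = ‖t‖ ^ 2 := by
    rw [EuclideanSpace.real_norm_sq_eq]
    simp [dotProduct, pow_two]
  rw [h2, ← Measure.map_map (by fun_prop) (by fun_prop), charFun_map_const_add, charFun_map_smul,
    charFun_stdGaussian, charFun_multivariateGaussian h1, ← Complex.exp_add, norm_smul,
    Matrix.smul_mulVec, Matrix.one_mulVec, dotProduct_smul, h3, real_inner_comm,
    Real.norm_of_nonneg ha]
  congr 1
  simp only [smul_eq_mul]
  push_cast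
  ring

theorem measurable_isoGaussian_sq {d : ℕ} (t : ℝ) :
    Measurable (fun x : EuclideanSpace ℝ (Fin d) => isoGaussian (t • x) ((1 - t) ^ 2)) := by
  have h : (fun x : EuclideanSpace ℝ (Fin d) => isoGaussian (t • x) ((1 - t) ^ 2))
      = fun x => ((isoGaussian (0 : EuclideanSpace ℝ (Fin d)) 1).map (Prod.mk x)).map
          (fun p => t • p.1 + |1 - t| • p.2) := by
    funext x
    rw [← sq_abs (1 - t), isoGaussian_sq_eq_map _ (abs_nonneg _),
      Measure.map_map (by fun_prop) (by fun_prop)]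
    rfl
  have : SFinite (isoGaussian (0 : EuclideanSpace ℝ (Fin d)) 1) := by
    unfold isoGaussian; infer_instance
  rw [h]
  exact (Measure.measurable_map _ (by fun_prop)).comp Measurable.map_prodMk_left

/-- The noising kernel `q_t(· | x) = N(t x, (1-t)² I)`. -/
def noisingKernel (d : ℕ) (t : ℝ) :
    Kernel (EuclideanSpace ℝ (Fin d)) (EuclideanSpace ℝ (Fin d)) where
  toFun x := isoGaussian (t • x) ((1 - t) ^ 2)
  measurable' := measurable_isoGaussian_sq t

instance (d : ℕ) (t : ℝ) : IsMarkovKernel (noisingKernel d t) where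
  isProbabilityMeasure x := by
    change IsProbabilityMeasure (isoGaussian (t • x) ((1 - t) ^ 2))
    unfold isoGaussian
    infer_instance

section

variable {Ω : Type*} {mΩ : MeasurableSpace Ω} {d : ℕ}

/-- `W` (read at times `t ≥ 0`) is a `d`-dimensional Brownian motion with respect to the
filtration `ℱ`. -/
structure IsBrownianMotion (W : ℝ → Ω → EuclideanSpace ℝ (Fin d)) (ℱ : Filtration ℝ mΩ)
    (P : Measure Ω) : Prop where
  adapted : ∀ t, 0 ≤ t → Measurable[ℱ t] (W t)
  coord : ∀ i, IsBrownianReal (fun (t : ℝ≥0) ω => W t ω i) P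
  indep_coord : iIndepFun (fun i ω (t : ℝ≥0) => W t ω i) P
  indep_incr : ∀ s t, 0 ≤ s → s ≤ t →
    Indep (ℱ s) (MeasurableSpace.comap (fun ω => W t ω - W s ω) inferInstance) P

/-- For `f` continuous on `[s, t]`: the random vector `Y` is (a version of) the stochastic
integral `∫ₛᵗ f dW`, i.e. the limit in probability of the left-point Riemann sums along the
uniform partitions of `[s, t]`. -/
def IsStochIntegral (f : ℝ → ℝ) (W : ℝ → Ω → EuclideanSpace ℝ (Fin d)) (P : Measure Ω)
    (s t : ℝ) (Y : Ω → EuclideanSpace ℝ (Fin d)) : Prop :=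
  TendstoInMeasure P
    (fun (n : ℕ) ω => ∑ k ∈ Finset.range n, f (s + k * ((t - s) / n)) •
      (W (s + (k + 1) * ((t - s) / n)) ω - W (s + k * ((t - s) / n)) ω))
    atTop Y

/-- The laws of `Y s` converge weakly to `ν` as `s ↓ 0`. -/
def LawTendstoAtZero {F : Type*} [TopologicalSpace F] [MeasurableSpace F]
    (Y : ℝ → Ω → F) (P : Measure Ω) (ν : Measure F) : Prop :=
  ∀ f : F →ᵇ ℝ, Tendsto (fun s => ∫ ω, f (Y s ω) ∂P) (𝓝[>] 0) (𝓝 (∫ y, f y ∂ν))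

/-- `X` (read at times `0 < t ≤ 1`) is a base dynamic with drift `b`:
`dX = b(X,t) dt + σ(t) dW` on `(0,1]`, with initial law `p₀ = N(0, I)`.
Since `σ²` is not integrable at `0`, the equation is imposed on all `[s,t] ⊆ (0,1]` and the
initial law is the weak limit of the law of `X s` as `s ↓ 0`. -/
structure IsBaseDynamic (b : EuclideanSpace ℝ (Fin d) → ℝ → EuclideanSpace ℝ (Fin d))
    (W : ℝ → Ω → EuclideanSpace ℝ (Fin d)) (ℱ : Filtration ℝ mΩ)
    (X : ℝ → Ω → EuclideanSpace ℝ (Fin d)) (P : Measure Ω) : Prop where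
  adapted : ∀ t ∈ Ioc (0 : ℝ) 1, Measurable[ℱ t] (X t)
  continuous_paths : ∀ᵐ ω ∂P, ContinuousOn (fun t => X t ω) (Ioc 0 1)
  integrable_drift : ∀ᵐ ω ∂P, ∀ s ∈ Ioc (0 : ℝ) 1,
    IntervalIntegrable (fun r => b (X r ω) r) volume s 1
  sde : ∀ s t : ℝ, 0 < s → s ≤ t → t ≤ 1 →
    IsStochIntegral diffusionCoeff W P s t
      (fun ω => X t ω - X s ω - ∫ r in s..t, b (X r ω) r)
  initial_law : LawTendstoAtZero X P (isoGaussian 0 1)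

/-- Linearity of the drift: `b(x,t) = D(t) x` for (almost) all times `t ∈ (0,1]` and all `x`, with
a scalar coefficient `D` for which `∫ₜ¹ D` exists for every `t ∈ (0,1]`. -/
def IsLinearDrift (b : EuclideanSpace ℝ (Fin d) → ℝ → EuclideanSpace ℝ (Fin d)) : Prop :=
  ∃ D : ℝ → ℝ, (∀ t ∈ Ioc (0 : ℝ) 1, IntervalIntegrable D volume t 1) ∧
    ∀ᵐ t ∂(volume.restrict (Ioc (0 : ℝ) 1)), ∀ x, b x t = D t • x

/-- Memorylessness `p_{0,1} = p₀ ⊗ p₁`, where `p₀ = N(0,I)` and `p_{0,1}` is the weak limit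
of the law of `(X s, X 1)` as `s ↓ 0`. -/
def IsMemoryless (X : ℝ → Ω → EuclideanSpace ℝ (Fin d)) (P : Measure Ω) : Prop :=
  LawTendstoAtZero (fun s ω => (X s ω, X 1 ω)) P ((isoGaussian 0 1).prod (P.map (X 1)))

/-- The conditional law of `X t` given `X 1` is `N(t X₁, (1-t)² I)`, for every `t ∈ (0,1]`. -/
def MatchesNoisingKernel (X : ℝ → Ω → EuclideanSpace ℝ (Fin d)) (P : Measure Ω) : Prop :=
  ∀ t ∈ Ioc (0 : ℝ) 1, HasCondDistrib (X t) (X 1) (noisingKernel d t) P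

/-- The three conditions on the base dynamic `X` with drift `b`. -/
def SatisfiesConditions (b : EuclideanSpace ℝ (Fin d) → ℝ → EuclideanSpace ℝ (Fin d))
    (X : ℝ → Ω → EuclideanSpace ℝ (Fin d)) (P : Measure Ω) : Prop :=
  IsLinearDrift b ∧ IsMemoryless X P ∧ MatchesNoisingKernel X P

end

/-- `D(t) = (2Ct² - 1) / (t (2Ct² - 2t + 1))`. -/
def admissibleCoeff (C t : ℝ) : ℝ :=
  (2 * C * t ^ 2 - 1) / (t * (2 * C * t ^ 2 - 2 * t + 1))

end

/-!
With a linear drift `D(t) x` the equation is solved explicitly. If `E' = -D E`, then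
`E(t) X_t - E(s) X_s` is the Wiener integral of `E σ` over `[s, t]`: a centred Gaussian vector
independent of the past, of variance `∫ₛᵗ E² σ²` (`IsBaseDynamic.isGaussianIncrement`). No general
stochastic calculus is needed for this. Along uniform partitions, `E(t) X_t - E(s) X_s` is the
pathwise limit of sums of `E(r_k)` times increments of the martingale part `X - ∫ b`
(`IsIntegratingFactor.tendsto_sum`); those increments are in turn limits in probability of sums of
Brownian increments, and the class of Gaussian increments is stable under sums and limits.

*Necessity.* The solution formula gives `X₁ = a X_t + N` with `a = exp (∫ₜ¹ D)`, and the noising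
kernel gives `X_t = t X₁ + (1 - t) Z`, with Gaussian noises. Writing the joint characteristic
function of `(X₁, X_t)` in both ways yields a functional equation for the characteristic function
of `X₁`, and a single time `t ∈ (0, 1)` forces it to be that of some `N(0, κ I)`
(`exists_eq_cexp_of_functional_equation`). Comparing covariances at every `t` then gives
`exp (∫ₜ¹ D) = κ t / (κ t² + (1 - t)²)`, so `κ > 0`. With `κ = 2C - 1` the denominator is
`q(t) = 2Ct² - 2t + 1`, and differentiating the logarithm gives the formula for `D` almost
everywhere (`ae_eq_admissibleCoeff`).

*Sufficiency.* For the admissible coefficient one may take `E(t) = t / q(t)`, for which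
`∫ₛᵗ E² σ² = t² / q(t) - s² / q(s)`. Since `E(s) → 0` as `s → 0`, while the laws of `X_s` converge,
the initial value is forgotten and `X_t ~ N(0, q(t) I)` (`IsBaseDynamic.charFun_admissible`); at
`t = 1` this is the terminal law. The joint characteristic function of `(X₁, X_t)` is then explicit
and is the one prescribed by the noising kernel. Memorylessness follows from the noising kernel
alone, letting `t → 0` in `X_t = t X₁ + (1 - t) Z` (`MatchesNoisingKernel.isMemoryless`).
-/

noncomputable section

/-! ### Riemann sums along uniform partitions -/

/-- The `k`-th point of the uniform partition of `[s, t]` into `n` pieces. -/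
def partitionPoint (s t : ℝ) (n k : ℕ) : ℝ := s + k * ((t - s) / n)

theorem partitionPoint_zero (s t : ℝ) (n : ℕ) : partitionPoint s t n 0 = s := by
  simp [partitionPoint]

theorem partitionPoint_self (s t : ℝ) {n : ℕ} (hn : n ≠ 0) : partitionPoint s t n n = t := by
  have : (n : ℝ) ≠ 0 := by exact_mod_cast hn
  simp only [partitionPoint]
  field_simp
  ring

theorem partitionPoint_succ (s t : ℝ) (n k : ℕ) :
    partitionPoint s t n (k + 1) = partitionPoint s t n k + (t - s) / n := by
  simp only [partitionPoint]
  push_cast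
  ring

theorem monotone_partitionPoint {s t : ℝ} (hst : s ≤ t) (n : ℕ) :
    Monotone (partitionPoint s t n) := by
  refine monotone_nat_of_le_succ fun k => ?_
  rw [partitionPoint_succ]
  have : 0 ≤ (t - s) / n := div_nonneg (by linarith) (by positivity)
  linarith

theorem partitionPoint_mem {s t : ℝ} (hst : s ≤ t) {n k : ℕ} (hk : k ≤ n) :
    partitionPoint s t n k ∈ Icc s t := by
  have h := monotone_partitionPoint hst n
  refine ⟨by simpa [partitionPoint_zero] using h (Nat.zero_le k), ?_⟩
  rcases Nat.eq_zero_or_pos n with rfl | hn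
  · simpa [partitionPoint] using hst
  · simpa [partitionPoint_self s t hn.ne'] using h hk

theorem Icc_partitionPoint_subset {s t : ℝ} (hst : s ≤ t) {n k : ℕ} (hk : k < n) :
    Icc (partitionPoint s t n k) (partitionPoint s t n (k + 1)) ⊆ Icc s t :=
  Icc_subset_Icc (partitionPoint_mem hst hk.le).1 (partitionPoint_mem hst hk).2

theorem intervalIntegrable_partition {V : Type*} [NormedAddCommGroup V] {s t : ℝ} (hst : s ≤ t)
    {h : ℝ → V} (hh : IntervalIntegrable h volume s t) {n k : ℕ} (hk : k < n) :
    IntervalIntegrable h volume (partitionPoint s t n k) (partitionPoint s t n (k + 1)) := by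
  refine hh.mono_set ?_
  rw [uIcc_of_le hst, uIcc_of_le (monotone_partitionPoint hst n k.le_succ)]
  exact Icc_partitionPoint_subset hst hk

theorem sum_integral_partition {V : Type*} [NormedAddCommGroup V] [NormedSpace ℝ V]
    {s t : ℝ} (hst : s ≤ t) {h : ℝ → V} (hh : IntervalIntegrable h volume s t)
    {n : ℕ} (hn : n ≠ 0) :
    ∑ k ∈ Finset.range n, ∫ r in (partitionPoint s t n k)..(partitionPoint s t n (k + 1)), h r
      = ∫ r in s..t, h r := by
  rw [intervalIntegral.sum_integral_adjacent_intervals (a := partitionPoint s t n)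
    (fun k hk => intervalIntegrable_partition hst hh hk), partitionPoint_zero,
    partitionPoint_self s t hn]

/-- Along uniform partitions, integrating against an integrable weight a function which is
continuous in the partition points and in the integration variable, and vanishes on the diagonal,
gives nothing in the limit. All the Riemann sum limits below are instances of this. -/
theorem tendsto_sum_integral_partition {V : Type*} [NormedAddCommGroup V] [NormedSpace ℝ V]
    {s t : ℝ} (hst : s ≤ t) {h : ℝ → ℝ} (hh : IntervalIntegrable h volume s t)
    {F : ℝ × ℝ × ℝ → V} (hF : ContinuousOn F (Icc s t ×ˢ Icc s t ×ˢ Icc s t))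
    (hdiag : ∀ r ∈ Icc s t, F (r, r, r) = 0) :
    Tendsto (fun n : ℕ => ∑ k ∈ Finset.range n,
      ∫ r in (partitionPoint s t n k)..(partitionPoint s t n (k + 1)),
        h r • F (partitionPoint s t n k, partitionPoint s t n (k + 1), r)) atTop (𝓝 0) := by
  rw [Metric.tendsto_atTop]
  intro ε hε
  set H := ∫ r in s..t, ‖h r‖ with hH
  have hH0 : 0 ≤ H := intervalIntegral.integral_nonneg hst fun _ _ => norm_nonneg _
  have huc := (isCompact_Icc.prod
    (isCompact_Icc.prod isCompact_Icc)).uniformContinuousOn_of_continuous hF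
  rw [Metric.uniformContinuousOn_iff] at huc
  obtain ⟨δ, hδ, hδF⟩ := huc (ε / (H + 1)) (by positivity)
  obtain ⟨N, hN⟩ := exists_nat_gt ((t - s) / δ)
  have hN0 : (0 : ℝ) < N := lt_of_le_of_lt (div_nonneg (by linarith) hδ.le) hN
  refine ⟨N, fun n hn => ?_⟩
  have hn0 : (0 : ℝ) < n := lt_of_lt_of_le hN0 (by exact_mod_cast hn)
  have hmesh : (t - s) / n < δ := by
    rw [div_lt_iff₀ hδ] at hN
    rw [div_lt_iff₀ hn0]
    have : (N : ℝ) ≤ n := by exact_mod_cast hn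
    nlinarith
  rw [dist_zero_right]
  have key : ∀ k ∈ Finset.range n,
      ‖∫ r in (partitionPoint s t n k)..(partitionPoint s t n (k + 1)),
        h r • F (partitionPoint s t n k, partitionPoint s t n (k + 1), r)‖
      ≤ ∫ r in (partitionPoint s t n k)..(partitionPoint s t n (k + 1)),
        ‖h r‖ * (ε / (H + 1)) := by
    intro k hk
    rw [Finset.mem_range] at hk
    have hle := monotone_partitionPoint hst n k.le_succ
    refine intervalIntegral.norm_integral_le_of_norm_le hle (ae_of_all _ fun r hr => ?_)
      ((intervalIntegrable_partition hst hh hk).norm.mul_const _)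
    rw [norm_smul]
    refine mul_le_mul_of_nonneg_left ?_ (norm_nonneg _)
    have hr' := Icc_partitionPoint_subset hst hk (Ioc_subset_Icc_self hr)
    have h1 := partitionPoint_mem hst hk.le
    have h2 := partitionPoint_mem hst (Nat.succ_le_of_lt hk)
    have hs := partitionPoint_succ s t n k
    have h3 := hδF (partitionPoint s t n k, partitionPoint s t n (k + 1), r) ⟨h1, h2, hr'⟩
      (r, r, r) ⟨hr', hr', hr'⟩ ?_
    · rw [hdiag r hr', dist_zero_right] at h3
      exact h3.le
    · simp only [Prod.dist_eq, dist_self, Real.dist_eq]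
      rw [max_lt_iff, max_lt_iff, abs_lt, abs_lt]
      have := hr.1
      have := hr.2
      refine ⟨⟨?_, ?_⟩, ⟨?_, ?_⟩, hδ⟩ <;> linarith
  refine (norm_sum_le _ _).trans_lt ((Finset.sum_le_sum key).trans_lt ?_)
  have hn1 : n ≠ 0 := by exact_mod_cast hn0.ne'
  rw [sum_integral_partition hst (hh.norm.mul_const _) hn1, intervalIntegral.integral_mul_const,
    ← hH, mul_div_assoc', div_lt_iff₀ (by positivity)]
  nlinarith

/-- Riemann–Stieltjes sums of a continuous `g` against `h dr` converge to `∫ g h`. -/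
theorem tendsto_sum_mul_integral_partition {s t : ℝ} (hst : s ≤ t) {g h : ℝ → ℝ}
    (hg : ContinuousOn g (Icc s t)) (hh : IntervalIntegrable h volume s t) :
    Tendsto (fun n : ℕ => ∑ k ∈ Finset.range n, g (partitionPoint s t n k) *
      ∫ r in (partitionPoint s t n k)..(partitionPoint s t n (k + 1)), h r) atTop
      (𝓝 (∫ r in s..t, g r * h r)) := by
  have hgh : IntervalIntegrable (fun r => g r * h r) volume s t :=
    hh.continuousOn_mul (by rwa [uIcc_of_le hst])
  have h0 := tendsto_sum_integral_partition hst hh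
    (F := fun x => g x.1 - g x.2.2)
    ((hg.comp continuousOn_fst fun x hx => hx.1).sub
      (hg.comp (by fun_prop) fun x hx => hx.2.2)) (fun r _ => sub_self _)
  have h1 := h0.add_const (∫ r in s..t, g r * h r)
  rw [zero_add] at h1
  refine h1.congr' ?_
  filter_upwards [eventually_ne_atTop 0] with n hn
  rw [← sum_integral_partition hst hgh hn, ← Finset.sum_add_distrib]
  refine Finset.sum_congr rfl fun k hk => ?_
  rw [Finset.mem_range] at hk
  have hi := intervalIntegrable_partition hst hh hk
  have hi' := intervalIntegrable_partition hst hgh hk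
  have : ∀ r, h r • (g (partitionPoint s t n k) - g r)
      = g (partitionPoint s t n k) * h r - g r * h r := fun r => by
    rw [smul_eq_mul]; ring
  simp only [this]
  rw [intervalIntegral.integral_sub (hi.const_mul _) hi', intervalIntegral.integral_const_mul]
  ring

/-! ### Integrating factors -/

/-- `E` is an integrating factor on `[s, t]` for the linear equation `x' = D x`: it is continuous
and satisfies `E' = -D E` in integrated form. -/
structure IsIntegratingFactor (D E : ℝ → ℝ) (s t : ℝ) : Prop where
  continuousOn : ContinuousOn E (Icc s t)
  sub_eq : ∀ x ∈ Icc s t, ∀ y ∈ Icc s t, x ≤ y → E y - E x = -∫ r in x..y, D r * E r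

theorem IsIntegratingFactor.of_hasDerivAt {D E : ℝ → ℝ} {s t : ℝ} (hD : ContinuousOn D (Icc s t))
    (hE : ∀ r ∈ Icc s t, HasDerivAt E (-(D r * E r)) r) : IsIntegratingFactor D E s t := by
  have hc : ContinuousOn E (Icc s t) := fun r hr => (hE r hr).continuousAt.continuousWithinAt
  refine ⟨hc, fun x hx y hy hxy => ?_⟩
  have hsub : uIcc x y ⊆ Icc s t := by
    rw [uIcc_of_le hxy]; exact Icc_subset_Icc hx.1 hy.2
  rw [← intervalIntegral.integral_neg, intervalIntegral.integral_eq_sub_of_hasDerivAt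
    (fun r hr => hE r (hsub hr))]
  exact ((hD.mul hc).neg.mono hsub).intervalIntegrable

/-- For a merely integrable coefficient, the exponential of the primitive is still an integrating
factor. -/
theorem isIntegratingFactor_exp {D : ℝ → ℝ} {s t : ℝ} (hD : IntervalIntegrable D volume s t)
    (hst : s ≤ t) : IsIntegratingFactor D (fun r => Real.exp (∫ x in r..t, D x)) s t := by
  set G : ℝ → ℝ := fun r => ∫ x in r..t, D x with hG
  have hint : ∀ x ∈ Icc s t, ∀ y ∈ Icc s t, IntervalIntegrable D volume x y := fun x hx y hy =>
    hD.mono_set (by rw [uIcc_of_le hst]; exact uIcc_subset_Icc hx hy)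
  have ht : t ∈ Icc s t := ⟨hst, le_rfl⟩
  have hGc : ContinuousOn G (Icc s t) := by
    have h := intervalIntegral.continuousOn_primitive_interval' hD (a := t)
      (by rw [uIcc_of_le hst]; exact ht)
    rw [uIcc_of_le hst] at h
    exact h.neg.congr fun r _ => intervalIntegral.integral_symm _ _
  have hGsub : ∀ x ∈ Icc s t, ∀ y ∈ Icc s t, G y - G x = -∫ r in x..y, D r := fun x hx y hy => by
    have := intervalIntegral.integral_add_adjacent_intervals (hint x hx y hy) (hint y hy t ht)
    simp only [hG]
    linarith
  refine ⟨Real.continuous_exp.comp_continuousOn hGc, fun x hx y hy hxy => ?_⟩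
  have hsub : Icc x y ⊆ Icc s t := Icc_subset_Icc hx.1 hy.2
  have hGc' := hGc.mono hsub
  have hDxy := hint x hx y hy
  have hDE : IntervalIntegrable (fun r => D r * Real.exp (G r)) volume x y :=
    hDxy.mul_continuousOn (by rw [uIcc_of_le hxy]; exact Real.continuous_exp.comp_continuousOn hGc')
  -- the difference quotient of `exp`, extended continuously to the diagonal
  set Φ : ℝ → ℝ := dslope Real.exp 0
  have hΦc : Continuous Φ := by
    rw [← continuousOn_univ, continuousOn_dslope univ_mem]
    exact ⟨Real.continuous_exp.continuousOn, Real.differentiableAt_exp⟩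
  have hΦ0 : Φ 0 = 1 := by simp [Φ, dslope_same]
  have hΦ : ∀ a b, Real.exp b - Real.exp a = Real.exp a * Φ (b - a) * (b - a) := fun a b => by
    have h := sub_smul_dslope Real.exp 0 (b - a)
    rw [sub_zero, smul_eq_mul, Real.exp_zero, Real.exp_sub] at h
    have : Real.exp a ≠ 0 := (Real.exp_pos a).ne'
    rw [mul_assoc, mul_comm (Φ _), h]
    field_simp
  have h0 := tendsto_sum_integral_partition hxy hDxy
    (F := fun z => Real.exp (G z.1) * Φ (G z.2.1 - G z.1) - Real.exp (G z.2.2)) (by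
      have c1 : ContinuousOn (fun z : ℝ × ℝ × ℝ => G z.1) (Icc x y ×ˢ Icc x y ×ˢ Icc x y) :=
        hGc'.comp (by fun_prop) fun z hz => hz.1
      have c2 : ContinuousOn (fun z : ℝ × ℝ × ℝ => G z.2.1) (Icc x y ×ˢ Icc x y ×ˢ Icc x y) :=
        hGc'.comp (by fun_prop) fun z hz => hz.2.1
      have c3 : ContinuousOn (fun z : ℝ × ℝ × ℝ => G z.2.2) (Icc x y ×ˢ Icc x y ×ˢ Icc x y) :=
        hGc'.comp (by fun_prop) fun z hz => hz.2.2
      exact ((Real.continuous_exp.comp_continuousOn c1).mul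
        (hΦc.comp_continuousOn (c2.sub c1))).sub (Real.continuous_exp.comp_continuousOn c3))
    (fun r _ => by simp [hΦ0])
  -- every partition gives the same value, which is therefore the limit `0`
  have h1 : ∀ᶠ n : ℕ in atTop, (∑ k ∈ Finset.range n,
      ∫ r in (partitionPoint x y n k)..(partitionPoint x y n (k + 1)),
        D r • (Real.exp (G (partitionPoint x y n k)) *
          Φ (G (partitionPoint x y n (k + 1)) - G (partitionPoint x y n k)) - Real.exp (G r)))
      = -(Real.exp (G y) - Real.exp (G x)) - ∫ r in x..y, D r * Real.exp (G r) := by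
    filter_upwards [eventually_ne_atTop 0] with n hn
    rw [← sum_integral_partition hxy hDE hn]
    have htel := Finset.sum_range_sub (fun k => Real.exp (G (partitionPoint x y n k))) n
    rw [partitionPoint_zero, partitionPoint_self x y hn] at htel
    rw [← htel, ← Finset.sum_neg_distrib, ← Finset.sum_sub_distrib]
    refine Finset.sum_congr rfl fun k hk => ?_
    rw [Finset.mem_range] at hk
    have m1 := hsub (partitionPoint_mem hxy hk.le)
    have m2 := hsub (partitionPoint_mem hxy (Nat.succ_le_of_lt hk))
    have hi := intervalIntegrable_partition hxy hDxy hk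
    have hi' := intervalIntegrable_partition hxy hDE hk
    simp only [smul_eq_mul, mul_sub]
    rw [intervalIntegral.integral_sub (hi.mul_const _) hi', intervalIntegral.integral_mul_const,
      hΦ, hGsub _ m1 _ m2]
    ring
  have h2 := tendsto_nhds_unique (h0.congr' h1) tendsto_const_nhds
  change Real.exp (G y) - Real.exp (G x) = -∫ r in x..y, D r * Real.exp (G r)
  linarith

/-- Variation of constants along partitions: if `x` is continuous and the increments of
`x - ∫ D x` are weighted by an integrating factor `E`, their sums converge to the increment
of `E x`. -/
theorem IsIntegratingFactor.tendsto_sum {V : Type*} [NormedAddCommGroup V] [NormedSpace ℝ V]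
    [CompleteSpace V] {D E : ℝ → ℝ} {s t : ℝ} (hE : IsIntegratingFactor D E s t) (hst : s ≤ t)
    (hD : IntervalIntegrable D volume s t) {x : ℝ → V} (hx : ContinuousOn x (Icc s t)) :
    Tendsto (fun n : ℕ => ∑ k ∈ Finset.range n, E (partitionPoint s t n k) •
      (x (partitionPoint s t n (k + 1)) - x (partitionPoint s t n k)
        - ∫ r in (partitionPoint s t n k)..(partitionPoint s t n (k + 1)), D r • x r)) atTop
      (𝓝 (E t • x t - E s • x s)) := by
  have hEc := hE.continuousOn
  have hDx : IntervalIntegrable (fun r => D r • x r) volume s t :=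
    hD.smul_continuousOn (by rwa [uIcc_of_le hst])
  have hDE : IntervalIntegrable (fun r => D r * E r) volume s t :=
    hD.mul_continuousOn (by rwa [uIcc_of_le hst])
  have h0 := tendsto_sum_integral_partition hst hD
    (F := fun z => E z.1 • x z.2.2 - E z.2.2 • x z.2.1)
    (((hEc.comp (by fun_prop) fun z hz => hz.1).smul
      (hx.comp (by fun_prop) fun z hz => hz.2.2)).sub
      ((hEc.comp (by fun_prop) fun z hz => hz.2.2).smul
      (hx.comp (by fun_prop) fun z hz => hz.2.1))) (fun r _ => sub_self _)
  have h1 := h0.const_sub (E t • x t - E s • x s)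
  rw [sub_zero] at h1
  refine h1.congr' ?_
  filter_upwards [eventually_ne_atTop 0] with n hn
  have htel := Finset.sum_range_sub
    (fun k => E (partitionPoint s t n k) • x (partitionPoint s t n k)) n
  rw [partitionPoint_zero, partitionPoint_self s t hn] at htel
  rw [← htel, ← Finset.sum_sub_distrib]
  refine Finset.sum_congr rfl fun k hk => ?_
  rw [Finset.mem_range] at hk
  have m1 := partitionPoint_mem hst hk.le
  have m2 := partitionPoint_mem hst (Nat.succ_le_of_lt hk)
  have hi := intervalIntegrable_partition hst hDx hk
  have hi' := intervalIntegrable_partition hst hDE hk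
  have hs := hE.sub_eq _ m1 _ m2 (monotone_partitionPoint hst n k.le_succ)
  have hsplit : ∀ r, D r • (E (partitionPoint s t n k) • x r
      - E r • x (partitionPoint s t n (k + 1)))
      = E (partitionPoint s t n k) • (D r • x r)
        - (D r * E r) • x (partitionPoint s t n (k + 1)) := fun r => by
    rw [smul_sub, smul_comm, mul_smul]
  have hs' : ∫ r in (partitionPoint s t n k)..(partitionPoint s t n (k + 1)), D r * E r
      = E (partitionPoint s t n k) - E (partitionPoint s t n (k + 1)) := by
    simp only [Nat.succ_eq_add_one] at hs
    linarith
  have hi2 : IntervalIntegrable (fun r => E (partitionPoint s t n k) • (D r • x r)) volume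
      (partitionPoint s t n k) (partitionPoint s t n (k + 1)) := hi.smul _
  have hi3 : IntervalIntegrable (fun r => (D r * E r) • x (partitionPoint s t n (k + 1))) volume
      (partitionPoint s t n k) (partitionPoint s t n (k + 1)) :=
    hi'.smul_continuousOn continuousOn_const
  simp only [hsplit]
  rw [intervalIntegral.integral_sub hi2 hi3, intervalIntegral.integral_smul,
    intervalIntegral.integral_smul_const, hs']
  module

/-! ### Gaussian increments relative to a σ-algebra -/

section Increments

variable {Ω : Type*} {mΩ : MeasurableSpace Ω} {d : ℕ} {P : Measure Ω}

/-- `Y` is known at `ℋ`, and it is an `N(0, v I)` vector independent of `𝒢`. Law and independence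
are encoded together, by testing `exp(i⟨Y, w⟩)` against all bounded `𝒢`-measurable functions. -/
structure IsGaussianIncrement (𝒢 ℋ : MeasurableSpace Ω) (P : Measure[mΩ] Ω)
    (Y : Ω → EuclideanSpace ℝ (Fin d)) (v : ℝ) : Prop where
  aestronglyMeasurable : AEStronglyMeasurable[ℋ] Y P
  integral_mul_cexp : ∀ g : Ω → ℂ, AEStronglyMeasurable[𝒢] g P → (∀ ω, ‖g ω‖ ≤ 1) →
    ∀ w : EuclideanSpace ℝ (Fin d),
      ∫ ω, g ω * Complex.exp ((inner ℝ (Y ω) w : ℝ) * Complex.I) ∂P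
        = (∫ ω, g ω ∂P) * Complex.exp (-(v * ‖w‖ ^ 2 / 2 : ℝ))

theorem norm_cexp_inner_mul_I (x : ℝ) : ‖Complex.exp ((x : ℂ) * Complex.I)‖ ≤ 1 :=
  (Complex.norm_exp_ofReal_mul_I x).le

theorem aestronglyMeasurable_cexp_inner {m : MeasurableSpace Ω}
    {Y : Ω → EuclideanSpace ℝ (Fin d)} (hY : AEStronglyMeasurable[m] Y P)
    (w : EuclideanSpace ℝ (Fin d)) :
    AEStronglyMeasurable[m] (fun ω => Complex.exp ((inner ℝ (Y ω) w : ℝ) * Complex.I)) P :=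
  (show Continuous fun y : EuclideanSpace ℝ (Fin d) =>
    Complex.exp ((inner ℝ y w : ℝ) * Complex.I) by fun_prop).comp_aestronglyMeasurable hY

/-- A version of `aestronglyMeasurable_of_tendsto_ae` for a sub-σ-algebra, to which null sets need
not belong. -/
theorem aestronglyMeasurable_of_tendsto_ae_sub {m : MeasurableSpace Ω} {E : Type*}
    [NormedAddCommGroup E] [CompleteSpace E] {f : ℕ → Ω → E} {g : Ω → E}
    (hf : ∀ n, AEStronglyMeasurable[m] (f n) P)
    (hfg : ∀ᵐ ω ∂P, Tendsto (fun n => f n ω) atTop (𝓝 (g ω))) : AEStronglyMeasurable[m] g P := by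
  choose f' hf' hff' using hf
  refine ⟨fun ω => limUnder atTop fun n => f' n ω, StronglyMeasurable.limUnder hf', ?_⟩
  filter_upwards [hfg, ae_all_iff.2 hff'] with ω h1 h2
  simp only [h2] at h1
  exact h1.limUnder_eq.symm

namespace IsGaussianIncrement

variable {𝒢 ℋ 𝒦 : MeasurableSpace Ω} {Y Z : Ω → EuclideanSpace ℝ (Fin d)} {v v' : ℝ}

theorem mono_right (h : IsGaussianIncrement 𝒢 ℋ P Y v) (hle : ℋ ≤ 𝒦) :
    IsGaussianIncrement 𝒢 𝒦 P Y v :=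
  ⟨h.1.mono hle, h.2⟩

theorem zero : IsGaussianIncrement 𝒢 ℋ P (fun _ => (0 : EuclideanSpace ℝ (Fin d))) 0 := by
  refine ⟨aestronglyMeasurable_const, fun g _ _ w => ?_⟩
  simp

theorem smul (h : IsGaussianIncrement 𝒢 ℋ P Y v) (c : ℝ) :
    IsGaussianIncrement 𝒢 ℋ P (fun ω => c • Y ω) (c ^ 2 * v) := by
  refine ⟨h.1.const_smul c, fun g hg hg1 w => ?_⟩
  have := h.2 g hg hg1 (c • w)
  simp only [real_inner_smul_left]
  simp only [real_inner_smul_right, norm_smul, mul_pow, Real.norm_eq_abs, sq_abs] at this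
  rw [this]
  congr 4
  ring

/-- Consecutive increments add up: the first one is a legitimate test function for the
second. -/
theorem add (h : IsGaussianIncrement 𝒢 ℋ P Y v) (h' : IsGaussianIncrement ℋ 𝒦 P Z v')
    (hle : 𝒢 ≤ ℋ) (hle' : ℋ ≤ 𝒦) :
    IsGaussianIncrement 𝒢 𝒦 P (fun ω => Y ω + Z ω) (v + v') := by
  refine ⟨(h.1.mono hle').add h'.1, fun g hg hg1 w => ?_⟩
  have h1 := h'.2 (fun ω => g ω * Complex.exp ((inner ℝ (Y ω) w : ℝ) * Complex.I))
    ((hg.mono hle).mul (aestronglyMeasurable_cexp_inner h.1 w)) (fun ω => by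
      rw [norm_mul]
      exact mul_le_one₀ (hg1 ω) (norm_nonneg _) (norm_cexp_inner_mul_I _)) w
  rw [h.2 g hg hg1 w] at h1
  simp only [inner_add_left, Complex.ofReal_add, add_mul, Complex.exp_add, ← mul_assoc]
  rw [h1, mul_assoc, ← Complex.exp_add]
  congr 2
  push_cast
  ring

theorem sum {ι : Type*} [Preorder ι] {ℱ : Filtration ι mΩ} {r : ℕ → ι} (hr : Monotone r)
    {Y : ℕ → Ω → EuclideanSpace ℝ (Fin d)} {v : ℕ → ℝ} (c : ℕ → ℝ) (n : ℕ)
    (h : ∀ k < n, IsGaussianIncrement (ℱ (r k)) (ℱ (r (k + 1))) P (Y k) (v k)) :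
    IsGaussianIncrement (ℱ (r 0)) (ℱ (r n)) P (fun ω => ∑ k ∈ Finset.range n, c k • Y k ω)
      (∑ k ∈ Finset.range n, c k ^ 2 * v k) := by
  induction n with
  | zero => simpa using zero
  | succ n ih =>
    simp only [Finset.sum_range_succ]
    exact (ih fun k hk => h k (hk.trans n.lt_succ_self)).add ((h n n.lt_succ_self).smul (c n))
      (ℱ.mono (hr n.zero_le)) (ℱ.mono (hr n.le_succ))

theorem of_tendsto_ae [IsFiniteMeasure P] (h𝒢 : 𝒢 ≤ mΩ) (hℋ : ℋ ≤ mΩ)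
    {Y : ℕ → Ω → EuclideanSpace ℝ (Fin d)} {v : ℕ → ℝ} {Y' : Ω → EuclideanSpace ℝ (Fin d)}
    {v' : ℝ} (h : ∀ n, IsGaussianIncrement 𝒢 ℋ P (Y n) (v n))
    (hY : ∀ᵐ ω ∂P, Tendsto (fun n => Y n ω) atTop (𝓝 (Y' ω)))
    (hv : Tendsto v atTop (𝓝 v')) : IsGaussianIncrement 𝒢 ℋ P Y' v' := by
  refine ⟨aestronglyMeasurable_of_tendsto_ae_sub (fun n => (h n).1) hY, fun g hg hg1 w => ?_⟩
  have h1 : Tendsto (fun n => ∫ ω, g ω * Complex.exp ((inner ℝ (Y n ω) w : ℝ) * Complex.I) ∂P)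
      atTop (𝓝 (∫ ω, g ω * Complex.exp ((inner ℝ (Y' ω) w : ℝ) * Complex.I) ∂P)) := by
    refine tendsto_integral_of_dominated_convergence (fun _ => 1)
      (fun n => (hg.mono h𝒢).mul (aestronglyMeasurable_cexp_inner ((h n).1.mono hℋ) w))
      (integrable_const _) (fun n => ae_of_all _ fun ω => ?_) ?_
    · rw [norm_mul]
      exact mul_le_one₀ (hg1 ω) (norm_nonneg _) (norm_cexp_inner_mul_I _)
    · filter_upwards [hY] with ω hω
      have hc : Continuous fun y : EuclideanSpace ℝ (Fin d) =>
        g ω * Complex.exp ((inner ℝ y w : ℝ) * Complex.I) := by fun_prop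
      exact (hc.tendsto _).comp hω
  have hc : Continuous fun x : ℝ => (∫ ω, g ω ∂P) * Complex.exp (-(x * ‖w‖ ^ 2 / 2 : ℝ)) := by
    fun_prop
  refine tendsto_nhds_unique h1 (((hc.tendsto _).comp hv).congr fun n => ?_)
  exact ((h n).2 g hg hg1 w).symm

theorem of_tendstoInMeasure [IsFiniteMeasure P] (h𝒢 : 𝒢 ≤ mΩ) (hℋ : ℋ ≤ mΩ)
    {Y : ℕ → Ω → EuclideanSpace ℝ (Fin d)} {v : ℕ → ℝ} {Y' : Ω → EuclideanSpace ℝ (Fin d)}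
    {v' : ℝ} (h : ∀ n, IsGaussianIncrement 𝒢 ℋ P (Y n) (v n))
    (hY : TendstoInMeasure P Y atTop Y')
    (hv : Tendsto v atTop (𝓝 v')) : IsGaussianIncrement 𝒢 ℋ P Y' v' := by
  obtain ⟨ns, hns, hlim⟩ := hY.exists_seq_tendsto_ae
  exact of_tendsto_ae h𝒢 hℋ (fun n => h (ns n)) hlim (hv.comp hns.tendsto_atTop)

end IsGaussianIncrement

/-! ### Increments of Brownian motion and of the martingale part -/

theorem IsBrownianMotion.charFun_sub {ℱ : Filtration ℝ mΩ} [IsProbabilityMeasure P]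
    {W : ℝ → Ω → EuclideanSpace ℝ (Fin d)}
    (hW : IsBrownianMotion W ℱ P) {s t : ℝ} (hs : 0 ≤ s) (hst : s ≤ t)
    (w : EuclideanSpace ℝ (Fin d)) :
    ∫ ω, Complex.exp ((inner ℝ (W t ω - W s ω) w : ℝ) * Complex.I) ∂P
      = Complex.exp (-((t - s) * ‖w‖ ^ 2 / 2 : ℝ)) := by
  set t' : ℝ≥0 := ⟨t, hs.trans hst⟩
  set s' : ℝ≥0 := ⟨s, hs⟩
  have h1 : ∀ ω, Complex.exp ((inner ℝ (W t ω - W s ω) w : ℝ) * Complex.I)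
      = ∏ i, Complex.exp (w i * (W t' ω i - W s' ω i : ℝ) * Complex.I) := fun ω => by
    rw [← Complex.exp_sum, ← Finset.sum_mul, PiLp.inner_apply]
    congr 2
    push_cast
    refine Finset.sum_congr rfl fun i _ => ?_
    have ht' : (t' : ℝ) = t := rfl
    have hs' : (s' : ℝ) = s := rfl
    simp [ht', hs']
  simp only [h1]
  have hm : ∀ t : ℝ≥0, Measurable (W t) := fun t => (hW.adapted t t.2).mono (ℱ.le _) le_rfl
  have h2 := hW.indep_coord.integral_fun_prod_comp (𝕜 := ℂ)
    (f := fun i (x : ℝ≥0 → ℝ) => Complex.exp (w i * (x t' - x s' : ℝ) * Complex.I))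
    (fun i => (measurable_pi_lambda _ fun r => by
      have := hm r
      fun_prop).aemeasurable)
    (fun i => by
      have : Measurable fun x : ℝ≥0 → ℝ =>
        Complex.exp (w i * (x t' - x s' : ℝ) * Complex.I) := by fun_prop
      exact this.aestronglyMeasurable)
  rw [h2]
  have h3 : ∀ i, ∫ ω, Complex.exp (w i * (W t' ω i - W s' ω i : ℝ) * Complex.I) ∂P
      = Complex.exp (-((t - s) * w i ^ 2 / 2 : ℝ)) := fun i => by
    have hl := (hW.coord i).toIsPreBrownianReal.hasLaw_sub t' s'
    have h4 := charFun_apply_real (μ := gaussianReal 0 (nndist t'.1 s'.1)) (t := w i)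
    rw [charFun_gaussianReal, ← hl.map_eq, integral_map hl.aemeasurable
      (by fun_prop)] at h4
    simp only [Pi.sub_apply] at h4
    rw [← h4]
    congr 1
    have : ((nndist t'.1 s'.1 : ℝ≥0) : ℝ) = t - s := by
      rw [coe_nndist, Real.dist_eq]; exact abs_of_nonneg (by simpa [t', s'] using hst)
    have h5 : (((nndist t'.1 s'.1 : ℝ≥0) : ℝ) : ℂ) = t - s := by rw [this]; push_cast; rfl
    rw [h5]
    push_cast
    ring
  simp only [h3]
  rw [← Complex.exp_sum, EuclideanSpace.real_norm_sq_eq]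
  congr 1
  push_cast
  rw [Finset.sum_neg_distrib, Finset.mul_sum, Finset.sum_div]

theorem IsBrownianMotion.isGaussianIncrement_sub {ℱ : Filtration ℝ mΩ} [IsProbabilityMeasure P]
    {W : ℝ → Ω → EuclideanSpace ℝ (Fin d)}
    (hW : IsBrownianMotion W ℱ P) {s t : ℝ} (hs : 0 ≤ s) (hst : s ≤ t) :
    IsGaussianIncrement (ℱ s) (ℱ t) P (fun ω => W t ω - W s ω) (t - s) := by
  have hmt : Measurable[ℱ t] fun ω => W t ω - W s ω :=
    (hW.adapted t (hs.trans hst)).sub ((hW.adapted s hs).mono (ℱ.mono hst) le_rfl)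
  have hsm : StronglyMeasurable[ℱ t] fun ω => W t ω - W s ω := hmt.stronglyMeasurable
  refine ⟨⟨_, hsm, EventuallyEq.rfl⟩, fun g hg hg1 w => ?_⟩
  obtain ⟨g', hg', hgg'⟩ := hg
  have hi : IndepFun g' (fun ω => W t ω - W s ω) P :=
    indep_of_indep_of_le_left (hW.indep_incr s t hs hst) hg'.measurable.comap_le
  have h1 := hi.integral_fun_comp_mul_comp (𝕜 := ℂ) (f := fun z : ℂ => z)
    (g := fun y : EuclideanSpace ℝ (Fin d) => Complex.exp ((inner ℝ y w : ℝ) * Complex.I))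
    (hg'.measurable.mono (ℱ.le s) le_rfl).aemeasurable
    (hmt.mono (ℱ.le t) le_rfl).aemeasurable
    aestronglyMeasurable_id
    (show Continuous fun y : EuclideanSpace ℝ (Fin d) =>
      Complex.exp ((inner ℝ y w : ℝ) * Complex.I) by fun_prop).aestronglyMeasurable
  rw [hW.charFun_sub hs hst w] at h1
  rw [integral_congr_ae hgg', ← h1]
  refine integral_congr_ae ?_
  filter_upwards [hgg'] with ω hω
  rw [hω]

/-- A Wiener integral of a continuous deterministic function over `[s, t]` is a Gaussian
increment, with the variance given by the Itô isometry. -/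
theorem IsStochIntegral.isGaussianIncrement {ℱ : Filtration ℝ mΩ} [IsProbabilityMeasure P]
    {W : ℝ → Ω → EuclideanSpace ℝ (Fin d)} (hW : IsBrownianMotion W ℱ P) {f : ℝ → ℝ} {s t : ℝ}
    (hs : 0 ≤ s) (hst : s ≤ t) (hf : ContinuousOn f (Icc s t))
    {Y : Ω → EuclideanSpace ℝ (Fin d)} (hY : IsStochIntegral f W P s t Y) :
    IsGaussianIncrement (ℱ s) (ℱ t) P Y (∫ r in s..t, f r ^ 2) := by
  have hlim := tendsto_sum_mul_integral_partition hst (g := fun r => f r ^ 2) (h := fun _ => 1)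
    (hf.pow 2) intervalIntegrable_const
  simp only [mul_one] at hlim
  refine IsGaussianIncrement.of_tendstoInMeasure (ℱ.le s) (ℱ.le t) (fun n => ?_) hY hlim
  have hmon := monotone_partitionPoint hst n
  have h := IsGaussianIncrement.sum (ℱ := ℱ) (P := P) hmon
    (Y := fun k ω => W (partitionPoint s t n (k + 1)) ω - W (partitionPoint s t n k) ω)
    (v := fun k => partitionPoint s t n (k + 1) - partitionPoint s t n k)
    (fun k => f (partitionPoint s t n k)) n (fun k hk =>
      hW.isGaussianIncrement_sub (hs.trans (partitionPoint_mem hst hk.le).1) (hmon k.le_succ))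
  rw [partitionPoint_zero] at h
  have h' := h.mono_right (ℱ.mono (partitionPoint_mem hst le_rfl).2)
  simpa [partitionPoint] using h'

theorem diffusionCoeff_sq {r : ℝ} (h0 : 0 < r) (h1 : r ≤ 1) :
    diffusionCoeff r ^ 2 = 2 * (1 - r) / r :=
  Real.sq_sqrt (div_nonneg (by linarith) h0.le)

theorem continuousOn_diffusionCoeff : ContinuousOn diffusionCoeff (Ioi 0) := by
  unfold diffusionCoeff
  refine ContinuousOn.sqrt (ContinuousOn.div (by fun_prop) (by fun_prop) fun r hr => ?_)
  exact (ne_of_gt hr)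

section Dynamic

variable {ℱ : Filtration ℝ mΩ} {W X : ℝ → Ω → EuclideanSpace ℝ (Fin d)}
  {b : EuclideanSpace ℝ (Fin d) → ℝ → EuclideanSpace ℝ (Fin d)}

theorem IsBaseDynamic.measurable (hX : IsBaseDynamic b W ℱ X P) {t : ℝ} (ht : t ∈ Ioc (0 : ℝ) 1) :
    Measurable (X t) :=
  (hX.adapted t ht).mono (ℱ.le t) le_rfl

/-- The explicit solution of the linear equation: `E(t) X_t - E(s) X_s` is the Wiener integral of
`E σ` over `[s, t]`, whence a Gaussian increment. -/
theorem IsBaseDynamic.isGaussianIncrement [IsProbabilityMeasure P] (hW : IsBrownianMotion W ℱ P)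
    (hX : IsBaseDynamic b W ℱ X P) {D E : ℝ → ℝ}
    (hb : ∀ᵐ r ∂(volume.restrict (Ioc (0 : ℝ) 1)), ∀ x, b x r = D r • x)
    {s t : ℝ} (hs : 0 < s) (hst : s ≤ t) (ht : t ≤ 1)
    (hD : IntervalIntegrable D volume s t) (hE : IsIntegratingFactor D E s t) :
    IsGaussianIncrement (ℱ s) (ℱ t) P (fun ω => E t • X t ω - E s • X s ω)
      (∫ r in s..t, E r ^ 2 * diffusionCoeff r ^ 2) := by
  have hσ : ContinuousOn diffusionCoeff (Icc s t) :=
    continuousOn_diffusionCoeff.mono fun r hr => hs.trans_le hr.1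
  have hσ2 : IntervalIntegrable (fun r => diffusionCoeff r ^ 2) volume s t :=
    (by rw [uIcc_of_le hst]; exact hσ.pow 2 :
      ContinuousOn (fun r => diffusionCoeff r ^ 2) (uIcc s t)).intervalIntegrable
  have hlim := tendsto_sum_mul_integral_partition hst (g := fun r => E r ^ 2)
    (hE.continuousOn.pow 2) hσ2
  refine IsGaussianIncrement.of_tendsto_ae (ℱ.le s) (ℱ.le t) (Y := fun n ω =>
    ∑ k ∈ Finset.range n, E (partitionPoint s t n k) •
      (X (partitionPoint s t n (k + 1)) ω - X (partitionPoint s t n k) ω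
        - ∫ r in (partitionPoint s t n k)..(partitionPoint s t n (k + 1)), b (X r ω) r))
    (fun n => ?_) ?_ hlim
  · have hmon := monotone_partitionPoint hst n
    have h := IsGaussianIncrement.sum (ℱ := ℱ) (P := P) hmon
      (Y := fun k ω => X (partitionPoint s t n (k + 1)) ω - X (partitionPoint s t n k) ω
        - ∫ r in (partitionPoint s t n k)..(partitionPoint s t n (k + 1)), b (X r ω) r)
      (v := fun k => ∫ r in (partitionPoint s t n k)..(partitionPoint s t n (k + 1)),
        diffusionCoeff r ^ 2)
      (fun k => E (partitionPoint s t n k)) n (fun k hk => by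
        have h0 := hs.trans_le (partitionPoint_mem hst hk.le).1
        exact IsStochIntegral.isGaussianIncrement hW h0.le (hmon k.le_succ)
          (hσ.mono (Icc_partitionPoint_subset hst hk))
          (hX.sde _ _ h0 (hmon k.le_succ)
            ((partitionPoint_mem hst (Nat.succ_le_of_lt hk)).2.trans ht)))
    rw [partitionPoint_zero] at h
    exact h.mono_right (ℱ.mono (partitionPoint_mem hst le_rfl).2)
  · filter_upwards [hX.continuous_paths] with ω hω
    have hc : ContinuousOn (fun r => X r ω) (Icc s t) :=
      hω.mono fun r hr => ⟨hs.trans_le hr.1, hr.2.trans ht⟩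
    refine (hE.tendsto_sum hst hD hc).congr fun n => Finset.sum_congr rfl fun k hk => ?_
    rw [Finset.mem_range] at hk
    congr 2
    refine intervalIntegral.integral_congr_ae ?_
    rw [ae_restrict_iff' measurableSet_Ioc] at hb
    filter_upwards [hb] with r hr hrk
    rw [uIoc_of_le (monotone_partitionPoint hst n k.le_succ)] at hrk
    have := Icc_partitionPoint_subset hst hk (Ioc_subset_Icc_self hrk)
    exact (hr ⟨hs.trans_le this.1, this.2.trans ht⟩ _).symm

end Dynamic

end Increments

/-! ### The noising kernel through characteristic functions -/

section Noising

variable {Ω : Type*} {mΩ : MeasurableSpace Ω} {d : ℕ} {P : Measure Ω}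

instance (m : EuclideanSpace ℝ (Fin d)) (v : ℝ) : IsProbabilityMeasure (isoGaussian m v) := by
  unfold isoGaussian
  infer_instance

theorem charFun_isoGaussian (m : EuclideanSpace ℝ (Fin d)) {v : ℝ} (hv : 0 ≤ v)
    (w : EuclideanSpace ℝ (Fin d)) :
    charFun (isoGaussian m v) w
      = Complex.exp ((inner ℝ m w : ℝ) * Complex.I) * Complex.exp (-(v * ‖w‖ ^ 2 / 2 : ℝ)) := by
  have h3 : w.ofLp ⬝ᵥ w.ofLp = ‖w‖ ^ 2 := by
    rw [EuclideanSpace.real_norm_sq_eq]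
    simp [dotProduct, pow_two]
  rw [isoGaussian, charFun_multivariateGaussian (Matrix.PosSemidef.one.smul hv),
    ← Complex.exp_add, Matrix.smul_mulVec, Matrix.one_mulVec, dotProduct_smul, h3,
    real_inner_comm]
  congr 1
  simp only [smul_eq_mul]
  push_cast
  ring

theorem integral_cexp_compProd_noisingKernel (μ : Measure (EuclideanSpace ℝ (Fin d)))
    [IsProbabilityMeasure μ] (t : ℝ) (u w : EuclideanSpace ℝ (Fin d)) :
    ∫ p, Complex.exp ((inner ℝ p.1 u + inner ℝ p.2 w : ℝ) * Complex.I) ∂(μ ⊗ₘ noisingKernel d t)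
      = charFun μ (u + t • w) * Complex.exp (-((1 - t) ^ 2 * ‖w‖ ^ 2 / 2 : ℝ)) := by
  have hint : Integrable (fun p : EuclideanSpace ℝ (Fin d) × EuclideanSpace ℝ (Fin d) =>
      Complex.exp ((inner ℝ p.1 u + inner ℝ p.2 w : ℝ) * Complex.I)) (μ ⊗ₘ noisingKernel d t) :=
    (integrable_const (1 : ℝ)).mono' (Continuous.aestronglyMeasurable (by fun_prop))
      (ae_of_all _ fun p => norm_cexp_inner_mul_I _)
  rw [Measure.integral_compProd hint, charFun_apply, ← integral_mul_const]
  refine integral_congr_ae (ae_of_all _ fun x => ?_)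
  have h := charFun_isoGaussian (t • x) (sq_nonneg (1 - t)) w
  rw [charFun_apply] at h
  simp only [Complex.ofReal_add, add_mul, Complex.exp_add]
  rw [integral_const_mul]
  change _ * ∫ y, Complex.exp ((inner ℝ y w : ℝ) * Complex.I) ∂(isoGaussian (t • x) ((1 - t) ^ 2))
    = _
  rw [h, ← mul_assoc, ← Complex.exp_add, inner_add_right, real_inner_smul_left,
    real_inner_smul_right]
  congr 2
  push_cast
  ring

/-- The joint law prescribed by the noising kernel, in terms of its characteristic function. -/
theorem hasCondDistrib_noisingKernel_iff [IsProbabilityMeasure P]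
    {X Y : Ω → EuclideanSpace ℝ (Fin d)} (hX : Measurable X) (hY : Measurable Y) (t : ℝ) :
    HasCondDistrib Y X (noisingKernel d t) P ↔ ∀ u w,
      ∫ ω, Complex.exp ((inner ℝ (X ω) u + inner ℝ (Y ω) w : ℝ) * Complex.I) ∂P
        = charFun (P.map X) (u + t • w) * Complex.exp (-((1 - t) ^ 2 * ‖w‖ ^ 2 / 2 : ℝ)) := by
  have : IsProbabilityMeasure (P.map X) := Measure.isProbabilityMeasure_map hX.aemeasurable
  have hXY : Measurable fun ω => (X ω, Y ω) := hX.prodMk hY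
  have hmap : ∀ u w, ∫ p, Complex.exp ((inner ℝ p.1 u + inner ℝ p.2 w : ℝ) * Complex.I)
      ∂(P.map fun ω => (X ω, Y ω))
      = ∫ ω, Complex.exp ((inner ℝ (X ω) u + inner ℝ (Y ω) w : ℝ) * Complex.I) ∂P := fun u w =>
    integral_map hXY.aemeasurable (Continuous.aestronglyMeasurable (by fun_prop))
  constructor
  · intro h u w
    rw [← hmap, h.map_eq, integral_cexp_compProd_noisingKernel]
  · intro h
    refine ⟨hXY.aemeasurable, ?_⟩
    have := Measure.isProbabilityMeasure_map (μ := P) hXY.aemeasurable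
    refine (MeasurableEquiv.toLp 2 (EuclideanSpace ℝ (Fin d) × EuclideanSpace ℝ (Fin d))
      ).map_measurableEquiv_injective (Measure.ext_of_charFun (funext fun z => ?_))
    have hchar : ∀ μ : Measure (EuclideanSpace ℝ (Fin d) × EuclideanSpace ℝ (Fin d)),
        charFun (μ.map (MeasurableEquiv.toLp 2 _)) z
        = ∫ p, Complex.exp ((inner ℝ p.1 z.fst + inner ℝ p.2 z.snd : ℝ) * Complex.I) ∂μ :=
      fun μ => by
        rw [charFun_apply, integral_map_equiv]
        rfl
    rw [hchar, hchar, hmap, h, integral_cexp_compProd_noisingKernel]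

/-- If `X_t = t X₁ + (1 - t) Z` in law, with `Z` standard Gaussian independent of `X₁`, then
letting `t → 0` exhibits `(Z, X₁)` as the limit law. -/
theorem MatchesNoisingKernel.isMemoryless [IsProbabilityMeasure P]
    {X : ℝ → Ω → EuclideanSpace ℝ (Fin d)} (hX : Measurable (X 1))
    (h : MatchesNoisingKernel X P) : IsMemoryless X P := by
  intro f
  have : IsProbabilityMeasure (P.map (X 1)) := Measure.isProbabilityMeasure_map hX.aemeasurable
  set μ := P.map (X 1)
  set γ : Measure (EuclideanSpace ℝ (Fin d)) := isoGaussian 0 1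
  have key : ∀ t ∈ Ioc (0 : ℝ) 1, ∫ ω, f (X t ω, X 1 ω) ∂P
      = ∫ p, f (t • p.2 + (1 - t) • p.1, p.2) ∂(γ.prod μ) := fun t ht => by
    have hc := h t ht
    have h1 : ∫ ω, f (X t ω, X 1 ω) ∂P = ∫ p, f (p.2, p.1) ∂(μ ⊗ₘ noisingKernel d t) := by
      rw [← hc.map_eq, integral_map hc.aemeasurable
        (Continuous.aestronglyMeasurable (by fun_prop))]
    have hint : Integrable (fun p => f (p.2, p.1)) (μ ⊗ₘ noisingKernel d t) :=
      (integrable_const ‖f‖).mono' (Continuous.aestronglyMeasurable (by fun_prop))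
        (ae_of_all _ fun p => f.norm_coe_le_norm _)
    have hint' : Integrable (fun p => f (t • p.2 + (1 - t) • p.1, p.2)) (γ.prod μ) :=
      (integrable_const ‖f‖).mono' (Continuous.aestronglyMeasurable (by fun_prop))
        (ae_of_all _ fun p => f.norm_coe_le_norm _)
    rw [h1, Measure.integral_compProd hint, integral_prod_symm _ hint']
    refine integral_congr_ae (ae_of_all _ fun x => ?_)
    change ∫ y, f (y, x) ∂(isoGaussian (t • x) ((1 - t) ^ 2)) = _
    rw [isoGaussian_sq_eq_map _ (by linarith [ht.2]), integral_map (by fun_prop)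
      (Continuous.aestronglyMeasurable (by fun_prop))]
  have hlim : Tendsto (fun t : ℝ => ∫ p, f (t • p.2 + (1 - t) • p.1, p.2) ∂(γ.prod μ))
      (𝓝[>] 0) (𝓝 (∫ p, f p ∂(γ.prod μ))) := by
    refine tendsto_integral_filter_of_dominated_convergence (fun _ => ‖f‖)
      (Eventually.of_forall fun t => Continuous.aestronglyMeasurable (by fun_prop))
      (Eventually.of_forall fun t => ae_of_all _ fun p => f.norm_coe_le_norm _)
      (integrable_const _) (ae_of_all _ fun p => ?_)
    have hc : Continuous fun t : ℝ => f (t • p.2 + (1 - t) • p.1, p.2) := by fun_prop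
    have := hc.tendsto 0
    simp only [zero_smul, sub_zero, one_smul, zero_add] at this
    exact this.mono_left nhdsWithin_le_nhds
  refine hlim.congr' ?_
  filter_upwards [Ioc_mem_nhdsGT (zero_lt_one' ℝ)] with t ht
  exact (key t ht).symm

/-- If `e' Y = e X + N` with `N` a Gaussian increment, this is the joint characteristic function
of `(Y, X)`. -/
theorem IsGaussianIncrement.integral_cexp {Ω : Type*} {𝒢 ℋ mΩ : MeasurableSpace Ω}
    {P : Measure Ω} (h𝒢 : 𝒢 ≤ mΩ)
    {X Y : Ω → EuclideanSpace ℝ (Fin d)} {e e' v : ℝ}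
    (h : IsGaussianIncrement 𝒢 ℋ P (fun ω => e' • Y ω - e • X ω) v) (hX : Measurable[𝒢] X)
    (u w : EuclideanSpace ℝ (Fin d)) :
    ∫ ω, Complex.exp ((inner ℝ (Y ω) (e' • u) + inner ℝ (X ω) w : ℝ) * Complex.I) ∂P
      = charFun (P.map X) (w + e • u) * Complex.exp (-(v * ‖u‖ ^ 2 / 2 : ℝ)) := by
  have hXs : StronglyMeasurable[𝒢] X := hX.stronglyMeasurable
  have h1 := h.2 _ (aestronglyMeasurable_cexp_inner ⟨_, hXs, EventuallyEq.rfl⟩ (w + e • u))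
    (fun ω => norm_cexp_inner_mul_I _) u
  rw [charFun_apply, integral_map (hX.mono h𝒢 le_rfl).aemeasurable
    (Continuous.aestronglyMeasurable (by fun_prop)), ← h1]
  congr 1 with ω
  rw [← Complex.exp_add]
  congr 1
  simp only [inner_add_right, inner_sub_left, real_inner_smul_left, real_inner_smul_right]
  push_cast
  ring

/-- Under a weak limit at time zero the laws are tight, so a vanishing factor kills the
process. -/
theorem LawTendstoAtZero.tendsto_charFun_smul [IsProbabilityMeasure P]
    {X : ℝ → Ω → EuclideanSpace ℝ (Fin d)} (hX : ∀ s ∈ Ioc (0 : ℝ) 1, Measurable (X s))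
    {ν : Measure (EuclideanSpace ℝ (Fin d))} [IsProbabilityMeasure ν]
    (h : LawTendstoAtZero X P ν) {c : ℝ → ℝ} (hc : Tendsto c (𝓝[>] 0) (𝓝 0))
    (u : EuclideanSpace ℝ (Fin d)) :
    Tendsto (fun s => charFun (P.map (X s)) (c s • u)) (𝓝[>] 0) (𝓝 1) := by
  -- the test functions `min 2 (δ |x| |u|)` dominate `|exp(i c⟨x, u⟩) - 1|` when `|c| ≤ δ`
  let f : ℝ → (EuclideanSpace ℝ (Fin d) →ᵇ ℝ) := fun δ =>
    BoundedContinuousFunction.ofNormedAddCommGroup (fun x => min 2 (|δ| * (‖x‖ * ‖u‖)))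
      (by fun_prop) 2 (fun x => by
        rw [Real.norm_of_nonneg (by positivity)]
        exact min_le_left _ _)
  have hf : ∀ δ x, f δ x = min 2 (|δ| * (‖x‖ * ‖u‖)) := fun _ _ => rfl
  have hf0 : Tendsto (fun δ => ∫ x, f δ x ∂ν) (𝓝[>] 0) (𝓝 0) := by
    have := tendsto_integral_filter_of_dominated_convergence (μ := ν) (l := 𝓝[>] (0 : ℝ))
      (F := fun δ x => f δ x) (f := fun _ => (0 : ℝ)) (fun _ => 2)
      (Eventually.of_forall fun δ => (f δ).continuous.aestronglyMeasurable)
      (Eventually.of_forall fun δ => ae_of_all _ fun x => by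
        rw [hf, Real.norm_of_nonneg (by positivity)]
        exact min_le_left _ _) (integrable_const _) (ae_of_all _ fun x => by
        simp only [hf]
        have hcont : Continuous fun δ : ℝ => min 2 (|δ| * (‖x‖ * ‖u‖)) := by fun_prop
        have := hcont.tendsto 0
        simp only [abs_zero, zero_mul, min_eq_right (zero_le_two (α := ℝ))] at this
        exact this.mono_left nhdsWithin_le_nhds)
    simpa using this
  rw [Metric.tendsto_nhds]
  intro ε hε
  obtain ⟨δ, hδε, hδ⟩ := ((hf0.eventually (gt_mem_nhds hε)).and self_mem_nhdsWithin).exists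
  filter_upwards [(h (f δ)).eventually (gt_mem_nhds hδε), Ioc_mem_nhdsGT (zero_lt_one' ℝ),
    hc.eventually (Metric.ball_mem_nhds 0 (show (0 : ℝ) < δ from hδ))] with s hs1 hs hcs
  have hcδ : |c s| ≤ |δ| := by
    rw [abs_of_pos (show (0 : ℝ) < δ from hδ)]
    rw [Real.dist_eq, sub_zero] at hcs
    exact hcs.le
  have hm := hX s hs
  refine lt_of_le_of_lt ?_ hs1
  have hi : Integrable (fun ω => Complex.exp ((inner ℝ (X s ω) (c s • u) : ℝ) * Complex.I)) P :=
    (integrable_const (1 : ℝ)).mono'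
      (aestronglyMeasurable_cexp_inner hm.aestronglyMeasurable _)
      (ae_of_all _ fun ω => norm_cexp_inner_mul_I _)
  have h1 : charFun (P.map (X s)) (c s • u) - 1
      = ∫ ω, (Complex.exp ((inner ℝ (X s ω) (c s • u) : ℝ) * Complex.I) - 1) ∂P := by
    rw [integral_sub hi (integrable_const _), charFun_apply, integral_map hm.aemeasurable
      (Continuous.aestronglyMeasurable (by fun_prop))]
    simp
  rw [dist_eq_norm, h1]
  refine norm_integral_le_of_norm_le ?_ (ae_of_all _ fun ω => ?_)
  · exact (integrable_const (2 : ℝ)).mono'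
      ((f δ).continuous.comp_aestronglyMeasurable hm.aestronglyMeasurable)
      (ae_of_all _ fun ω => by
        rw [hf, Real.norm_of_nonneg (by positivity)]
        exact min_le_left _ _)
  · rw [hf]
    refine le_min ?_ ?_
    · refine (norm_sub_le _ _).trans ?_
      rw [norm_one]
      linarith [norm_cexp_inner_mul_I (inner ℝ (X s ω) (c s • u))]
    · have h2 := Real.norm_exp_I_mul_ofReal_sub_one_le (x := inner ℝ (X s ω) (c s • u))
      rw [mul_comm Complex.I] at h2
      refine h2.trans ?_
      rw [real_inner_smul_right, norm_mul, Real.norm_eq_abs]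
      exact mul_le_mul hcδ (norm_inner_le_norm _ _) (norm_nonneg _) (abs_nonneg _)

end Noising

/-! ### The admissible coefficient -/

theorem admissibleDenom_pos {C : ℝ} (hC : 1 / 2 < C) (t : ℝ) : 0 < 2 * C * t ^ 2 - 2 * t + 1 := by
  rcases eq_or_ne t 0 with rfl | ht
  · norm_num
  · have h1 : 0 < t ^ 2 := by positivity
    nlinarith [sq_nonneg (t - 1), mul_pos (sub_pos.2 hC) h1]

theorem continuousOn_admissibleCoeff {C : ℝ} (hC : 1 / 2 < C) :
    ContinuousOn (admissibleCoeff C) (Ioi 0) := by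
  unfold admissibleCoeff
  exact ContinuousOn.div (by fun_prop) (by fun_prop) fun t ht =>
    (mul_pos ht (admissibleDenom_pos hC t)).ne'

theorem hasDerivAt_div_admissibleDenom {C : ℝ} (hC : 1 / 2 < C) {t : ℝ} (ht : t ≠ 0) :
    HasDerivAt (fun t => t / (2 * C * t ^ 2 - 2 * t + 1))
      (-(admissibleCoeff C t * (t / (2 * C * t ^ 2 - 2 * t + 1)))) t := by
  have hq := (admissibleDenom_pos hC t).ne'
  have h1 : HasDerivAt (fun t : ℝ => 2 * C * t ^ 2 - 2 * t + 1)
      (2 * C * (2 * t) - 2 * 1) t := by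
    have := (((hasDerivAt_pow 2 t).const_mul (2 * C)).sub
      ((hasDerivAt_id t).const_mul 2)).add_const 1
    simpa using this
  refine ((hasDerivAt_id' t).div h1 hq).congr_deriv ?_
  rw [admissibleCoeff]
  field_simp
  ring

/-- `t ↦ t / q(t)`, `q(t) = 2Ct² - 2t + 1`, is an integrating factor for the admissible
coefficient. -/
theorem isIntegratingFactor_admissibleCoeff {C : ℝ} (hC : 1 / 2 < C) {s t : ℝ} (hs : 0 < s) :
    IsIntegratingFactor (admissibleCoeff C) (fun t => t / (2 * C * t ^ 2 - 2 * t + 1)) s t :=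
  .of_hasDerivAt ((continuousOn_admissibleCoeff hC).mono fun _ hr => hs.trans_le hr.1)
    fun _ hr => hasDerivAt_div_admissibleDenom hC (hs.trans_le hr.1).ne'

theorem intervalIntegrable_admissibleCoeff {C : ℝ} (hC : 1 / 2 < C) {s t : ℝ} (hs : 0 < s)
    (hst : s ≤ t) : IntervalIntegrable (admissibleCoeff C) volume s t := by
  refine ContinuousOn.intervalIntegrable ?_
  rw [uIcc_of_le hst]
  exact (continuousOn_admissibleCoeff hC).mono fun _ hr => hs.trans_le hr.1

/-- The variance accumulated by the rescaled process: with `E = t / q(t)`, the function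
`E² σ²` is the derivative of `t² / q(t)`. -/
theorem integral_sq_mul_diffusionCoeff_sq {C : ℝ} (hC : 1 / 2 < C) {s t : ℝ} (hs : 0 < s)
    (hst : s ≤ t) (ht : t ≤ 1) :
    ∫ r in s..t, (r / (2 * C * r ^ 2 - 2 * r + 1)) ^ 2 * diffusionCoeff r ^ 2
      = t ^ 2 / (2 * C * t ^ 2 - 2 * t + 1) - s ^ 2 / (2 * C * s ^ 2 - 2 * s + 1) := by
  have hsub : ∀ r ∈ uIcc s t, 0 < r ∧ r ≤ 1 := fun r hr => by
    rw [uIcc_of_le hst] at hr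
    exact ⟨hs.trans_le hr.1, hr.2.trans ht⟩
  have hder : ∀ r ∈ uIcc s t, HasDerivAt (fun t : ℝ => t * (t / (2 * C * t ^ 2 - 2 * t + 1)))
      ((r / (2 * C * r ^ 2 - 2 * r + 1)) ^ 2 * diffusionCoeff r ^ 2) r := fun r hr => by
    obtain ⟨h0, h1⟩ := hsub r hr
    have hq := (admissibleDenom_pos hC r).ne'
    refine ((hasDerivAt_id' r).mul (hasDerivAt_div_admissibleDenom hC h0.ne')).congr_deriv ?_
    rw [diffusionCoeff_sq h0 h1, admissibleCoeff]
    field_simp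
    ring
  rw [intervalIntegral.integral_eq_sub_of_hasDerivAt hder]
  · simp only [mul_div_assoc', pow_two]
  · refine ContinuousOn.intervalIntegrable (ContinuousOn.mul (ContinuousOn.pow (ContinuousOn.div
      (by fun_prop) (by fun_prop) fun r _ => (admissibleDenom_pos hC r).ne') 2)
      ((continuousOn_diffusionCoeff.mono fun r hr => (hsub r hr).1).pow 2))

/-- An integrable coefficient is determined almost everywhere by its primitive. -/
theorem ae_eq_admissibleCoeff {C : ℝ} (hC : 1 / 2 < C) {D : ℝ → ℝ}
    (hD : ∀ t ∈ Ioc (0 : ℝ) 1, IntervalIntegrable D volume t 1)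
    (h : ∀ t ∈ Ioo (0 : ℝ) 1, Real.exp (∫ r in t..1, D r)
      = (2 * C - 1) * t / (2 * C * t ^ 2 - 2 * t + 1)) :
    ∀ᵐ t ∂(volume.restrict (Ioc (0 : ℝ) 1)), D t = admissibleCoeff C t := by
  have h1 : ∀ᵐ t : ℝ, ∀ n : ℕ, t ∈ uIcc (1 / ((n : ℝ) + 1)) 1 → ∀ c ∈ uIcc (1 / ((n : ℝ) + 1)) 1,
      HasDerivAt (fun x => ∫ r in c..x, D r) (D t) t :=
    ae_all_iff.2 fun n => (hD (1 / ((n : ℝ) + 1))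
      ⟨by positivity, by rw [div_le_one (by positivity)]; linarith [n.cast_nonneg (α := ℝ)]⟩
      ).ae_hasDerivAt_integral
  have h2 : ∀ᵐ t : ℝ, t ≠ 1 := by simp [ae_iff, measure_singleton]
  rw [ae_restrict_iff' measurableSet_Ioc]
  filter_upwards [h1, h2] with t ht1 htne ht
  have ht' : t ∈ Ioo (0 : ℝ) 1 := ⟨ht.1, lt_of_le_of_ne ht.2 htne⟩
  obtain ⟨n, hn⟩ := exists_nat_one_div_lt ht.1
  have hn1 : 1 / ((n : ℝ) + 1) ≤ 1 := hn.le.trans ht.2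
  have hder := ht1 n (by rw [uIcc_of_le hn1]; exact ⟨hn.le, ht.2⟩) 1
    (by rw [uIcc_of_le hn1]; exact ⟨hn1, le_rfl⟩)
  have hk : 0 < 2 * C - 1 := by linarith
  have hq := admissibleDenom_pos hC t
  have hR := (hasDerivAt_div_admissibleDenom hC ht.1.ne').log (div_pos ht.1 hq).ne'
  have heq : (fun x => ∫ r in (1 : ℝ)..x, D r) =ᶠ[𝓝 t] fun x =>
      -Real.log (2 * C - 1) - Real.log (x / (2 * C * x ^ 2 - 2 * x + 1)) := by
    filter_upwards [Ioo_mem_nhds ht'.1 ht'.2] with x hx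
    have h3 := congrArg Real.log (h x hx)
    rw [Real.log_exp, mul_div_assoc, Real.log_mul hk.ne'
      (div_pos hx.1 (admissibleDenom_pos hC x)).ne'] at h3
    rw [intervalIntegral.integral_symm, h3]
    ring
  have h4 := (hR.const_sub (-Real.log (2 * C - 1))).congr_of_eventuallyEq heq
  rw [hder.unique h4]
  have : t / (2 * C * t ^ 2 - 2 * t + 1) ≠ 0 := (div_pos ht.1 hq).ne'
  rw [neg_div, neg_neg, mul_div_assoc, div_self this, mul_one]

/-! ### Functional equations for the terminal characteristic function -/

section FunctionalEquation

variable {E : Type*} [NormedAddCommGroup E] [InnerProductSpace ℝ E]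

/-- The functional equation below expresses that `X_t = t X₁ + (1 - t) Z` and `X₁ = a X_t + N` with
independent Gaussian noises `Z`, `N` hold simultaneously. One time `t ∈ (0, 1)` already forces the
characteristic function `φ` of `X₁` to be Gaussian. -/
theorem exists_eq_cexp_of_functional_equation [Nontrivial E] {φ : E → ℂ} (hφ0 : φ 0 = 1)
    (hφc : Continuous φ) (hφ1 : ∀ z, ‖φ z‖ ≤ 1) {t a v : ℝ} (ht1 : t < 1) (ha : 0 < a)
    (h : ∀ u w, φ (u + t • w) * Complex.exp (-((1 - t) ^ 2 * ‖w‖ ^ 2 / 2 : ℝ))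
      = φ (t • (w + a • u)) * Complex.exp (-((1 - t) ^ 2 * ‖w + a • u‖ ^ 2 / 2 : ℝ))
        * Complex.exp (-(v * ‖u‖ ^ 2 / 2 : ℝ))) :
    ∃ κ : ℝ, 0 ≤ κ ∧ ∀ z, φ z = Complex.exp (-(κ * ‖z‖ ^ 2 / 2 : ℝ)) := by
  obtain ⟨e, he⟩ := exists_norm_eq E zero_le_one
  -- the choice `w = -a u` removes one of the two values of `φ`
  have h1 : ∀ u, φ ((1 - t * a) • u)
      = Complex.exp (-((v - (1 - t) ^ 2 * a ^ 2) * ‖u‖ ^ 2 / 2 : ℝ)) := fun u => by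
    have h2 := h u (-(a • u))
    rw [neg_add_cancel, smul_zero, hφ0, norm_neg, norm_smul, mul_pow, Real.norm_eq_abs, sq_abs,
      norm_zero] at h2
    have h3 : u + t • -(a • u) = (1 - t * a) • u := by module
    rw [h3] at h2
    have h4 : Complex.exp (-((v - (1 - t) ^ 2 * a ^ 2) * ‖u‖ ^ 2 / 2 : ℝ))
        * Complex.exp (-((1 - t) ^ 2 * (a ^ 2 * ‖u‖ ^ 2) / 2 : ℝ))
        = Complex.exp (-(v * ‖u‖ ^ 2 / 2 : ℝ)) := by
      rw [← Complex.exp_add]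
      congr 1
      push_cast
      ring
    refine mul_right_cancel₀ (Complex.exp_ne_zero _) (h2.trans ?_)
    rw [h4]
    simp
  have hc : 1 - t * a ≠ 0 := by
    intro hc
    have hta : t * a = 1 := by linarith
    have hv : v = (1 - t) ^ 2 * a ^ 2 := by
      have h2 := h1 e
      rw [hc, zero_smul, hφ0, he, ← Complex.ofReal_neg, ← Complex.ofReal_exp] at h2
      have h3 : Real.exp (-((v - (1 - t) ^ 2 * a ^ 2) * 1 ^ 2 / 2)) = 1 := by exact_mod_cast h2.symm
      rw [Real.exp_eq_one_iff] at h3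
      linarith
    -- the two factors multiplying the same value of `φ` differ, so `φ` vanishes on a
    -- line through the origin, except at the origin itself
    have hzero : ∀ δ : ℝ, δ ≠ 0 → φ ((t * δ) • e) = 0 := fun δ hδ => by
      have h2 := h e ((δ - a) • e)
      have e1 : e + t • (δ - a) • e = (t * δ) • e := by
        rw [smul_smul, mul_sub, hta]
        module
      have e2 : (δ - a) • e + a • e = δ • e := by module
      rw [e1, e2, smul_smul, norm_smul, norm_smul, he, mul_assoc, ← Complex.exp_add] at h2
      simp only [mul_one, one_pow, Real.norm_eq_abs, sq_abs] at h2
      by_contra hne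
      have h3 := mul_left_cancel₀ hne h2
      rw [← Complex.ofReal_neg, ← Complex.ofReal_neg, ← Complex.ofReal_neg, ← Complex.ofReal_add,
        ← Complex.ofReal_exp, ← Complex.ofReal_exp] at h3
      have h4 := Real.exp_injective (Complex.ofReal_injective h3)
      rw [hv] at h4
      have h5 : (1 - t) ^ 2 * a * δ = 0 := by linear_combination h4
      have h6 : (1 - t) ^ 2 ≠ 0 := pow_ne_zero 2 (by linarith)
      exact mul_ne_zero (mul_ne_zero h6 ha.ne') hδ h5
    have hlim : Tendsto (fun δ : ℝ => φ ((t * δ) • e)) (𝓝[≠] 0) (𝓝 1) := by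
      have hcont : Continuous fun δ : ℝ => φ ((t * δ) • e) := by fun_prop
      have := hcont.tendsto 0
      rw [mul_zero, zero_smul, hφ0] at this
      exact this.mono_left nhdsWithin_le_nhds
    have hlim0 : Tendsto (fun δ : ℝ => φ ((t * δ) • e)) (𝓝[≠] 0) (𝓝 0) :=
      tendsto_const_nhds.congr' (by
        filter_upwards [self_mem_nhdsWithin] with δ hδ
        exact (hzero δ hδ).symm)
    exact one_ne_zero (tendsto_nhds_unique hlim hlim0)
  set κ := (v - (1 - t) ^ 2 * a ^ 2) / (1 - t * a) ^ 2
  have hκ : ∀ z, φ z = Complex.exp (-(κ * ‖z‖ ^ 2 / 2 : ℝ)) := fun z => by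
    have h2 := h1 ((1 - t * a)⁻¹ • z)
    rw [smul_inv_smul₀ hc] at h2
    rw [h2, norm_smul, mul_pow, norm_inv, inv_pow, Real.norm_eq_abs, sq_abs]
    congr 3
    simp only [κ]
    field_simp
  refine ⟨κ, ?_, hκ⟩
  have h2 := hφ1 e
  rw [hκ, he, ← Complex.ofReal_neg, Complex.norm_exp_ofReal, Real.exp_le_one_iff] at h2
  linarith

/-- Comparing the cross terms of the two Gaussian exponents: the covariance `κ t` of `(X_t, X₁)`
computed from the noising kernel equals `a` times the variance of `X_t`. -/
theorem coeff_eq_of_functional_equation [Nontrivial E] {φ : E → ℂ} {κ : ℝ}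
    (hφ : ∀ z, φ z = Complex.exp (-(κ * ‖z‖ ^ 2 / 2 : ℝ))) {t a v : ℝ}
    (h : ∀ u w, φ (u + t • w) * Complex.exp (-((1 - t) ^ 2 * ‖w‖ ^ 2 / 2 : ℝ))
      = φ (t • (w + a • u)) * Complex.exp (-((1 - t) ^ 2 * ‖w + a • u‖ ^ 2 / 2 : ℝ))
        * Complex.exp (-(v * ‖u‖ ^ 2 / 2 : ℝ))) :
    κ * t = (κ * t ^ 2 + (1 - t) ^ 2) * a := by
  obtain ⟨e, he⟩ := exists_norm_eq E zero_le_one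
  have key : ∀ y : ℝ, κ * (1 + t * y) ^ 2 + (1 - t) ^ 2 * y ^ 2
      = κ * (t * (y + a)) ^ 2 + (1 - t) ^ 2 * (y + a) ^ 2 + v := fun y => by
    have h2 := h e (y • e)
    have e1 : e + t • y • e = (1 + t * y) • e := by module
    have e2 : y • e + a • e = (y + a) • e := by module
    rw [e1, e2, hφ, hφ, smul_smul, norm_smul, norm_smul, norm_smul, norm_smul, he] at h2
    simp only [mul_one, one_pow, Real.norm_eq_abs, sq_abs, ← Complex.ofReal_neg,
      ← Complex.ofReal_exp, ← Complex.ofReal_mul, ← Real.exp_add] at h2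
    linear_combination (-2) * Real.exp_injective (Complex.ofReal_injective h2)
  linear_combination (key 1 - key (-1)) / 4

end FunctionalEquation

/-! ### Necessity -/

section Dynamic

variable {Ω : Type*} {mΩ : MeasurableSpace Ω} {d : ℕ} {P : Measure Ω} [IsProbabilityMeasure P]
  {ℱ : Filtration ℝ mΩ} {W X : ℝ → Ω → EuclideanSpace ℝ (Fin d)}
  {b : EuclideanSpace ℝ (Fin d) → ℝ → EuclideanSpace ℝ (Fin d)}

/-- The joint characteristic function of `(X₁, X_t)`, computed once from the noising kernel and
once from the explicit solution on `[t, 1]`. -/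
theorem IsBaseDynamic.functional_equation (hW : IsBrownianMotion W ℱ P)
    (hX : IsBaseDynamic b W ℱ X P) (hker : MatchesNoisingKernel X P) {D : ℝ → ℝ}
    (hD : ∀ t ∈ Ioc (0 : ℝ) 1, IntervalIntegrable D volume t 1)
    (hb : ∀ᵐ t ∂(volume.restrict (Ioc (0 : ℝ) 1)), ∀ x, b x t = D t • x)
    {t : ℝ} (ht : t ∈ Ioc (0 : ℝ) 1) : ∃ v : ℝ, ∀ u w,
      charFun (P.map (X 1)) (u + t • w) * Complex.exp (-((1 - t) ^ 2 * ‖w‖ ^ 2 / 2 : ℝ))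
      = charFun (P.map (X 1)) (t • (w + Real.exp (∫ r in t..1, D r) • u))
        * Complex.exp (-((1 - t) ^ 2 * ‖w + Real.exp (∫ r in t..1, D r) • u‖ ^ 2 / 2 : ℝ))
        * Complex.exp (-(v * ‖u‖ ^ 2 / 2 : ℝ)) := by
  have hm1 := hX.measurable (right_mem_Ioc.2 zero_lt_one)
  have hmt := hX.measurable ht
  have hinc := hX.isGaussianIncrement hW hb ht.1 ht.2 le_rfl (hD t ht)
    (isIntegratingFactor_exp (hD t ht) ht.2)
  have hk := (hasCondDistrib_noisingKernel_iff hm1 hmt t).1 (hker t ht)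
  have hmarg : ∀ w, charFun (P.map (X t)) w = charFun (P.map (X 1)) (t • w)
      * Complex.exp (-((1 - t) ^ 2 * ‖w‖ ^ 2 / 2 : ℝ)) := fun w => by
    rw [← zero_add (t • w), ← hk 0 w, charFun_apply, integral_map hmt.aemeasurable
      (Continuous.aestronglyMeasurable (by fun_prop))]
    simp only [inner_zero_right, zero_add]
  refine ⟨∫ r in t..1, Real.exp (∫ x in r..1, D x) ^ 2 * diffusionCoeff r ^ 2, fun u w => ?_⟩
  have h1 := hinc.integral_cexp (ℱ.le t) (hX.adapted t ht) u w
  simp only [intervalIntegral.integral_same, Real.exp_zero, one_smul] at h1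
  rw [hk, hmarg] at h1
  exact h1

/-- Linearity and the noising kernel alone determine the drift; in dimension `0` every constant
`C` does. -/
theorem IsBaseDynamic.exists_admissible (hW : IsBrownianMotion W ℱ P)
    (hX : IsBaseDynamic b W ℱ X P) (hlin : IsLinearDrift b) (hker : MatchesNoisingKernel X P) :
    ∃ C : ℝ, 1 / 2 < C ∧ ∀ᵐ t ∂(volume.restrict (Ioc (0 : ℝ) 1)),
      ∀ x, b x t = admissibleCoeff C t • x := by
  rcases Nat.eq_zero_or_pos d with rfl | hd
  · exact ⟨1, by norm_num, ae_of_all _ fun t x => Subsingleton.elim _ _⟩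
  have : Nonempty (Fin d) := ⟨⟨0, hd⟩⟩
  have : Nontrivial (EuclideanSpace ℝ (Fin d)) := inferInstance
  obtain ⟨D, hD, hb⟩ := hlin
  have hm1 := hX.measurable (right_mem_Ioc.2 zero_lt_one)
  have : IsProbabilityMeasure (P.map (X 1)) := Measure.isProbabilityMeasure_map hm1.aemeasurable
  obtain ⟨v, hv⟩ := hX.functional_equation hW hker hD hb (t := 1 / 2) (by norm_num)
  obtain ⟨κ, hκ0, hκ⟩ := exists_eq_cexp_of_functional_equation (by simp) continuous_charFun
    (fun z => norm_charFun_le_one z) (by norm_num) (Real.exp_pos _) hv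
  have hcoef : ∀ t ∈ Ioc (0 : ℝ) 1,
      κ * t = (κ * t ^ 2 + (1 - t) ^ 2) * Real.exp (∫ r in t..1, D r) := fun t ht => by
    obtain ⟨v, hv⟩ := hX.functional_equation hW hker hD hb ht
    exact coeff_eq_of_functional_equation hκ hv
  have hκpos : 0 < κ := by
    have h1 := hcoef (1 / 2) (by norm_num)
    have h2 : 0 < (κ * (1 / 2) ^ 2 + (1 - 1 / 2) ^ 2) * Real.exp (∫ r in (1 / 2 : ℝ)..1, D r) :=
      mul_pos (by positivity) (Real.exp_pos _)
    linarith
  have hC : 1 / 2 < (κ + 1) / 2 := by linarith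
  refine ⟨(κ + 1) / 2, hC, ?_⟩
  have hae := ae_eq_admissibleCoeff hC hD fun t ht => by
    rw [eq_div_iff (admissibleDenom_pos hC t).ne']
    linear_combination -hcoef t (Ioo_subset_Ioc_self ht)
  filter_upwards [hb, hae] with t h1 h2 x
  rw [h1, h2]

/-! ### Sufficiency and the terminal law -/

theorem IsBaseDynamic.isGaussianIncrement_admissible (hW : IsBrownianMotion W ℱ P)
    (hX : IsBaseDynamic b W ℱ X P) {C : ℝ} (hC : 1 / 2 < C)
    (hb : ∀ᵐ t ∂(volume.restrict (Ioc (0 : ℝ) 1)), ∀ x, b x t = admissibleCoeff C t • x)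
    {s t : ℝ} (hs : 0 < s) (hst : s ≤ t) (ht : t ≤ 1) :
    IsGaussianIncrement (ℱ s) (ℱ t) P (fun ω => (t / (2 * C * t ^ 2 - 2 * t + 1)) • X t ω
        - (s / (2 * C * s ^ 2 - 2 * s + 1)) • X s ω)
      (t ^ 2 / (2 * C * t ^ 2 - 2 * t + 1) - s ^ 2 / (2 * C * s ^ 2 - 2 * s + 1)) := by
  rw [← integral_sq_mul_diffusionCoeff_sq hC hs hst ht]
  exact hX.isGaussianIncrement hW hb hs hst ht (intervalIntegrable_admissibleCoeff hC hs hst)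
    (isIntegratingFactor_admissibleCoeff hC hs)

/-- The marginal at time `t` is `N(0, q(t) I)`: the contribution of `X_s` disappears as `s → 0`,
because the integrating factor vanishes at `0`. -/
theorem IsBaseDynamic.charFun_admissible (hW : IsBrownianMotion W ℱ P)
    (hX : IsBaseDynamic b W ℱ X P) {C : ℝ} (hC : 1 / 2 < C)
    (hb : ∀ᵐ t ∂(volume.restrict (Ioc (0 : ℝ) 1)), ∀ x, b x t = admissibleCoeff C t • x)
    {t : ℝ} (ht : t ∈ Ioc (0 : ℝ) 1) (w : EuclideanSpace ℝ (Fin d)) :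
    charFun (P.map (X t)) w
      = Complex.exp (-((2 * C * t ^ 2 - 2 * t + 1) * ‖w‖ ^ 2 / 2 : ℝ)) := by
  have hq := admissibleDenom_pos hC
  have ht0 := ht.1
  set u := ((2 * C * t ^ 2 - 2 * t + 1) / t) • w
  have hw : w = (t / (2 * C * t ^ 2 - 2 * t + 1)) • u := by
    simp only [u]
    rw [smul_smul, div_mul_div_cancel₀ (hq t).ne', div_self ht0.ne', one_smul]
  have hrec : ∀ s ∈ Ioc (0 : ℝ) t, charFun (P.map (X t)) w
      = charFun (P.map (X s)) ((s / (2 * C * s ^ 2 - 2 * s + 1)) • u)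
        * Complex.exp (-((t ^ 2 / (2 * C * t ^ 2 - 2 * t + 1)
          - s ^ 2 / (2 * C * s ^ 2 - 2 * s + 1)) * ‖u‖ ^ 2 / 2 : ℝ)) := fun s hs => by
    have h1 := (hX.isGaussianIncrement_admissible hW hC hb hs.1 hs.2 ht.2).integral_cexp (ℱ.le s)
      (hX.adapted s ⟨hs.1, hs.2.trans ht.2⟩) u 0
    rw [zero_add, ← hw] at h1
    rw [← h1, charFun_apply, integral_map (hX.measurable ht).aemeasurable
      (Continuous.aestronglyMeasurable (by fun_prop))]
    simp only [inner_zero_right, add_zero]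
  have hc1 : Continuous fun s : ℝ => s / (2 * C * s ^ 2 - 2 * s + 1) :=
    Continuous.div (by fun_prop) (by fun_prop) fun s => (hq s).ne'
  have hc2 : Continuous fun s : ℝ => Complex.exp (-((t ^ 2 / (2 * C * t ^ 2 - 2 * t + 1)
      - s ^ 2 / (2 * C * s ^ 2 - 2 * s + 1)) * ‖u‖ ^ 2 / 2 : ℝ)) := by
    have : Continuous fun s : ℝ => s ^ 2 / (2 * C * s ^ 2 - 2 * s + 1) :=
      Continuous.div (by fun_prop) (by fun_prop) fun s => (hq s).ne'
    fun_prop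
  have hl1 := hc1.tendsto 0
  rw [zero_div] at hl1
  have hlim := (hX.initial_law.tendsto_charFun_smul (fun s hs => hX.measurable hs)
    (hl1.mono_left nhdsWithin_le_nhds) u).mul ((hc2.tendsto 0).mono_left nhdsWithin_le_nhds)
  have heq : (fun _ : ℝ => charFun (P.map (X t)) w) =ᶠ[𝓝[>] 0] fun s =>
      charFun (P.map (X s)) ((s / (2 * C * s ^ 2 - 2 * s + 1)) • u)
        * Complex.exp (-((t ^ 2 / (2 * C * t ^ 2 - 2 * t + 1)
          - s ^ 2 / (2 * C * s ^ 2 - 2 * s + 1)) * ‖u‖ ^ 2 / 2 : ℝ)) := by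
    filter_upwards [Ioc_mem_nhdsGT ht0] with s hs
    exact hrec s hs
  rw [tendsto_nhds_unique (tendsto_const_nhds.congr' heq) hlim, one_mul]
  congr 3
  simp only [u]
  rw [norm_smul, mul_pow, Real.norm_eq_abs, sq_abs, zero_pow two_ne_zero, zero_div, sub_zero]
  have := hq t
  generalize 2 * C * t ^ 2 - 2 * t + 1 = q at this ⊢
  field_simp

theorem IsBaseDynamic.matchesNoisingKernel (hW : IsBrownianMotion W ℱ P)
    (hX : IsBaseDynamic b W ℱ X P) {C : ℝ} (hC : 1 / 2 < C)
    (hb : ∀ᵐ t ∂(volume.restrict (Ioc (0 : ℝ) 1)), ∀ x, b x t = admissibleCoeff C t • x) :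
    MatchesNoisingKernel X P := by
  intro t ht
  have h1mem : (1 : ℝ) ∈ Ioc (0 : ℝ) 1 := right_mem_Ioc.2 zero_lt_one
  rw [hasCondDistrib_noisingKernel_iff (hX.measurable h1mem) (hX.measurable ht)]
  intro u w
  have hκ : 0 < 2 * C - 1 := by linarith
  have hq := admissibleDenom_pos hC t
  have h1 := (hX.isGaussianIncrement_admissible hW hC hb ht.1 ht.2 le_rfl).integral_cexp (ℱ.le t)
    (hX.adapted t ht) ((2 * C - 1) • u) w
  have hq1 : 2 * C * 1 ^ 2 - 2 * 1 + 1 = 2 * C - 1 := by ring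
  rw [hq1, smul_smul, one_div_mul_cancel hκ.ne', one_smul] at h1
  rw [h1, hX.charFun_admissible hW hC hb ht, hX.charFun_admissible hW hC hb h1mem, hq1,
    ← Complex.exp_add, ← Complex.exp_add]
  congr 1
  rw [norm_add_sq_real, norm_add_sq_real]
  simp only [norm_smul, real_inner_smul_right, mul_pow, Real.norm_eq_abs, sq_abs,
    real_inner_comm u w]
  norm_cast
  generalize hqt : 2 * C * t ^ 2 - 2 * t + 1 = q at hq ⊢
  field_simp
  rw [← hqt]
  ring

theorem IsBaseDynamic.map_one_eq (hW : IsBrownianMotion W ℱ P)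
    (hX : IsBaseDynamic b W ℱ X P) {C : ℝ} (hC : 1 / 2 < C)
    (hb : ∀ᵐ t ∂(volume.restrict (Ioc (0 : ℝ) 1)), ∀ x, b x t = admissibleCoeff C t • x) :
    P.map (X 1) = isoGaussian 0 (2 * C - 1) := by
  have h1mem : (1 : ℝ) ∈ Ioc (0 : ℝ) 1 := right_mem_Ioc.2 zero_lt_one
  have := Measure.isProbabilityMeasure_map (μ := P) (hX.measurable h1mem).aemeasurable
  refine Measure.ext_of_charFun (funext fun w => ?_)
  rw [hX.charFun_admissible hW hC hb h1mem, charFun_isoGaussian _ (by linarith)]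
  have hq1 : 2 * C * 1 ^ 2 - 2 * 1 + 1 = 2 * C - 1 := by ring
  rw [hq1, inner_zero_left]
  simp

theorem IsBaseDynamic.satisfiesConditions_iff (hW : IsBrownianMotion W ℱ P)
    (hX : IsBaseDynamic b W ℱ X P) : SatisfiesConditions b X P ↔
      ∃ C : ℝ, 1 / 2 < C ∧ ∀ᵐ t ∂(volume.restrict (Ioc (0 : ℝ) 1)),
        ∀ x, b x t = admissibleCoeff C t • x := by
  refine ⟨fun h => hX.exists_admissible hW h.1 h.2.2, fun ⟨C, hC, hb⟩ => ?_⟩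
  have hker := hX.matchesNoisingKernel hW hC hb
  exact ⟨⟨admissibleCoeff C, fun t ht => intervalIntegrable_admissibleCoeff hC ht.1 ht.2, hb⟩,
    hker.isMemoryless (hX.measurable (right_mem_Ioc.2 zero_lt_one)), hker⟩

end Dynamic

end

theorem proposition1 {Ω : Type*} {mΩ : MeasurableSpace Ω} (P : Measure Ω)
    [IsProbabilityMeasure P] (d : ℕ) (ℱ : Filtration ℝ mΩ)
    (W : ℝ → Ω → EuclideanSpace ℝ (Fin d)) (hW : IsBrownianMotion W ℱ P)
    (b : EuclideanSpace ℝ (Fin d) → ℝ → EuclideanSpace ℝ (Fin d))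
    (X : ℝ → Ω → EuclideanSpace ℝ (Fin d)) (hX : IsBaseDynamic b W ℱ X P) :
    -- the characterization, for almost every time
    (SatisfiesConditions b X P ↔
      ∃ C : ℝ, 1 / 2 < C ∧ ∀ᵐ t ∂(volume.restrict (Ioc (0 : ℝ) 1)),
        ∀ x, b x t = admissibleCoeff C t • x) ∧
    -- the characterization, for every time, when the drift is continuous in time
    ((∀ x, ContinuousOn (fun t => b x t) (Ioc 0 1)) →
      (SatisfiesConditions b X P ↔
        ∃ C : ℝ, 1 / 2 < C ∧ ∀ t ∈ Ioc (0 : ℝ) 1, ∀ x, b x t = admissibleCoeff C t • x)) ∧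
    -- the terminal marginal
    (∀ C : ℝ, 1 / 2 < C →
      (∀ᵐ t ∂(volume.restrict (Ioc (0 : ℝ) 1)), ∀ x, b x t = admissibleCoeff C t • x) →
      P.map (X 1) = isoGaussian 0 (2 * C - 1)) := by
  refine ⟨hX.satisfiesConditions_iff hW, fun hcont => ?_, fun C hC hb => hX.map_one_eq hW hC hb⟩
  rw [hX.satisfiesConditions_iff hW]
  refine exists_congr fun C => and_congr_right fun hC => ⟨fun hb t ht x => ?_, fun hb => ?_⟩
  · have hc : ContinuousOn (fun t => admissibleCoeff C t • x) (Ioc 0 1) :=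
      ((continuousOn_admissibleCoeff hC).mono Ioc_subset_Ioi_self).smul continuousOn_const
    exact Measure.eqOn_Ioc_of_ae_eq volume (hb.mono fun t h => h x) (hcont x) hc ht
  · rw [ae_restrict_iff' measurableSet_Ioc]
    exact ae_of_all _ hb
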